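/- Let $1<p<\infty$ and let $p^*$ be its conjugate exponent, $1/p+1/p^*=1$. Let $\mathcal X$ be a real Banach space that is smooth (every $x\neq 0$ has exactly one $x^*\in\mathcal X^*$ with $\|x^*\|=1$ and $\langle x^*,x\rangle=\|x\|$) and $p$-convex (for some $K>0$, $\inf\{1-\tfrac12\|z+w\|:\|z\|=\|w\|=1,\ \|z-w\|\ge\tau\}\ge K\tau^p$ for all $\tau\in(0,2]$). Let $\mathcal Y_1,\dots,\mathcal Y_N$ be arbitrary real Banach spaces, let $\mathcal Y=\mathcal Y_1\times\dots\times\mathcal Y_N$ carry the $\ell^r$ norm for some $1\le r\le\infty$, let $A=(A_1,\dots,A_N):\mathcal X\to\mathcal Y$ be a bounded linear operator, and let $y=(y_1,\dots,y_N)\in\operatorname{range}(A)$. For a Banach space $Z$, $s>1$ and $z\in Z$ let $J_s(z)=\{z^*\in Z^*:\langle z^*,z\rangle=\|z\|\,\|z^*\|,\ \|z^*\|=\|z\|^{s-1}\}$ be the duality map. On $\mathcal X$ it is single-valued; $J^*_{p^*}$ denotes the duality map with exponent $p^*$ on $\mathcal X^*$, which is single-valued with values in $\mathcal X\cong\mathcal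 X^{**}$; and $j_p$ denotes a fixed single-valued selection of the duality map $J_p$ of each $\mathcal Y_i$. For $z,w\in\mathcal X$ let $D(z,w)=\frac1{p^*}\|z\|^p+\frac1p\|w\|^p-\langle J_p(z),w\rangle$ be the Bregman distance. A minimum norm solution is an $x^\dagger\in\mathcal X$ with $Ax^\dagger=y$ and $\|x^\dagger\|=\inf\{\|x\|:Ax=y\}$. Let $\mu_1,\mu_2,\dots>0$ satisfy $\sum_{k\ge1}\mu_k=\infty$ and $\sum_{k\ge1}\mu_k^{p^*}<\infty$, let $i_1,i_2,\dots$ be independent random indices, each uniformly distributed on $\{1,\dots,N\}$, let $x_0\in\mathcal X$ be deterministic, and define $$x_{k+1}=J^*_{p^*}\bigl(J_p(x_k)-\mu_{k+1}A_{i_{k+1}}^*\,j_p(A_{i_{k+1}}x_k-y_{i_{k+1}})\bigr),\qquad k=0,1,2,\dots$$ Then almost surely $(x_k)$ converges in norm to some (possibly random) solution of $Ax=y$; in particular $$\mathbb P\Bigl(\lim_{k\to\infty}\ \inf_{\tilde x\in\mathcal X:\,A\tilde x=y}\|x_k-\tilde x\|=0\Bigr)=1.$$ Moreover, the minimum norm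 solution $x^\dagger$ exists and is unique, and if $J_p(x_0)\in\overline{\operatorname{range}(A^*)}$ (norm closure in $\mathcal X^*$), then $\lim_{k\to\infty}D(x_k,x^\dagger)=0$ almost surely. -/

import Mathlib

open Filter MeasureTheory ProbabilityTheory
open scoped Topology ENNReal

noncomputable section

namespace BanachSGD

section Geometry

variable {X : Type*} [NormedAddCommGroup X] [NormedSpace ℝ X]

/-- The (set-valued) duality map `J_p : X → 2^{X*}` with gauge function `t ↦ t ^ (p - 1)`. -/
def dualityMap (p : ℝ) (x : X) : Set (StrongDual ℝ X) :=
  {ξ | ξ x = ‖x‖ * ‖ξ‖ ∧ ‖x‖ ^ (p - 1) = ‖ξ‖}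

/-- The space `X` is smooth: every nonzero vector has a unique norming functional. -/
def IsSmooth (X : Type*) [NormedAddCommGroup X] [NormedSpace ℝ X] : Prop :=
  ∀ x : X, x ≠ 0 → ∃! ξ : StrongDual ℝ X, ξ x = ‖x‖ ∧ ‖ξ‖ = 1

/-- The modulus of convexity of `X`. It takes values in the extended reals, so that the infimum
of the empty set (which occurs only when `X` is the zero space) is `+∞`. -/
def modulusOfConvexity (X : Type*) [NormedAddCommGroup X] [NormedSpace ℝ X] (τ : ℝ) : EReal :=
  sInf {t : EReal | ∃ z w : X, ‖z‖ = 1 ∧ ‖w‖ = 1 ∧ τ ≤ ‖z - w‖ ∧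
    t = ((1 - (1 / 2) * ‖z + w‖ : ℝ) : EReal)}

/-- The space `X` is `p`-convex: its modulus of convexity is at least `K τ ^ p` on `(0, 2]`
for some `K > 0`. -/
def IsPConvex (X : Type*) [NormedAddCommGroup X] [NormedSpace ℝ X] (p : ℝ) : Prop :=
  ∃ K : ℝ, 0 < K ∧ ∀ τ : ℝ, 0 < τ → τ ≤ 2 →
    ((K * τ ^ p : ℝ) : EReal) ≤ modulusOfConvexity X τ

/-- The duality map of `X` as a single-valued map `X → X*`. For `1 < p` the set `J_p x` is
nonempty, and in a smooth space it has exactly one element, which is the value here. -/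
def J (p : ℝ) (x : X) : StrongDual ℝ X :=
  Classical.epsilon fun ξ : StrongDual ℝ X => ξ ∈ dualityMap p x

/-- The duality map of the dual space `X*` as a single-valued map `X* → X`, where `X` is regarded
as a part of `X**` through the canonical embedding. Exactly one `x` qualifies when `1 < q` and
`X` is a uniformly convex Banach space (which then is reflexive). -/
def Jstar (q : ℝ) (ξ : StrongDual ℝ X) : X :=
  Classical.epsilon fun x : X => NormedSpace.inclusionInDoubleDual ℝ X x ∈ dualityMap q ξ

/-- The Bregman distance `D(z, w)` of the functional `‖·‖ ^ p / p`; here `q` stands for the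
conjugate exponent of `p`. -/
def bregman (p q : ℝ) (z w : X) : ℝ :=
  (1 / q) * ‖z‖ ^ p + (1 / p) * ‖w‖ ^ p - J p z w

/-- `x` is a minimum norm solution of `A x = y`. -/
def IsMinNormSolution {Z : Type*} [NormedAddCommGroup Z] [NormedSpace ℝ Z]
    (A : X →L[ℝ] Z) (y : Z) (x : X) : Prop :=
  A x = y ∧ ‖x‖ = sInf {t : ℝ | ∃ z : X, A z = y ∧ t = ‖z‖}

/-- The adjoint `A* : Z* → X*` of a bounded linear operator `A : X → Z`. -/
def adjointMap {Z : Type*} [NormedAddCommGroup Z] [NormedSpace ℝ Z]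
    (A : X →L[ℝ] Z) (φ : StrongDual ℝ Z) : StrongDual ℝ X :=
  φ.comp A

end Geometry

section SGD

variable {X : Type*} [NormedAddCommGroup X] [NormedSpace ℝ X]
  {N : ℕ} {Y : Fin N → Type*} [∀ i, NormedAddCommGroup (Y i)] [∀ i, NormedSpace ℝ (Y i)]
  {r : ℝ≥0∞} [Fact (1 ≤ r)]

/-- The `i`-th component `A_i : X → Y_i` of an operator into the `ℓ^r` product of the `Y_i`. -/
def component (A : X →L[ℝ] PiLp r Y) (i : Fin N) : X →L[ℝ] Y i :=
  (PiLp.proj r Y i).comp A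

/-- The update direction `g(x, y, i) = A_i* j_i (A_i x - y_i)`. -/
def direction (A : X →L[ℝ] PiLp r Y) (y : PiLp r Y) (j : ∀ i, Y i → StrongDual ℝ (Y i))
    (x : X) (i : Fin N) : StrongDual ℝ X :=
  adjointMap (component A i) (j i (component A i x - y i))

/-- The iterates `x_{k+1} = J*_q (J_p x_k - μ_{k+1} g(x_k, y, s_{k+1}))` along a sequence of
indices `s_1, s_2, …`, started at `x₀`. The entries `μ 0` and `s 0` are not used. -/
def iterate (p q : ℝ) (A : X →L[ℝ] PiLp r Y) (y : PiLp r Y)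
    (j : ∀ i, Y i → StrongDual ℝ (Y i)) (μ : ℕ → ℝ) (x₀ : X) (s : ℕ → Fin N) : ℕ → X
  | 0 => x₀
  | k + 1 => Jstar q (J p (iterate p q A y j μ x₀ s k)
      - μ (k + 1) • direction A y j (iterate p q A y j μ x₀ s k) (s (k + 1)))

end SGD

end BanachSGD

end

/-!
The Bregman distance `D(x_k, z)` to a solution `z` serves as a Lyapunov function. Which inequality
makes it decrease depends on whether `p ≥ 2`.

For `p ≥ 2`, `p`-convexity gives the lower bound `D(z, w) ≥ c ‖z - w‖ ^ p`
(`IsPConvex.exists_bregman_ge`). With the three-point identity and Young's inequality this bounds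
one step (`exists_bregman_step_le`): up to a factor that tends to one, `D(x_k, z)` drops by the
step size times `‖A_i x_k - y_i‖ ^ p`, where `i` is the index drawn. So from some time on, on
every path and for every `z`, the distance decreases. As the index is independent of `x_k`,
taking expectations shows that the step sizes times the full residuals `∑ i, ‖A_i x_k - y_i‖ ^ p`
have an almost surely finite sum (`ae_summable_of_lyapunov`). The rest concerns a single path
(`exists_tendsto_of_summable_residual`): the residuals come arbitrarily close to zero since the
step sizes have an infinite sum; along the times at which the residual attains a new minimum the
iterates form a Cauchy sequence; its limit `z` is a solution, and the monotonicity of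
`D(x_k, z)` carries the convergence over to the whole sequence.

For `p < 2` a `p`-convex space has dimension at most one (`IsPConvex.exists_eq_smul`), and the
lower bound of the Bregman distance fails on the line. There the iteration is a scalar recursion
in `ξ = J_p x` which moves towards the solution, or past it by an amount that vanishes with the
step size (`tendsto_of_one_dimensional`); the step sizes at which a component with `A_i ≠ 0` is
drawn almost surely have an infinite sum (`ae_not_summable_ite`).

Closed convex sets have unique elements of minimal norm (`IsPConvex.existsUnique_min_norm`). This
gives the minimum norm solution and, applied to `{x | ξ x = 1}`, also the values of the duality
map of the dual, which by smoothness is a right inverse of `J_p` (`J_Jstar`). If `J_p x₀` lies in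
the closure of the range of the adjoint, then every `J_p x_k` annihilates the kernel of `A`, and
this forces the limit to have minimal norm (`norm_le_of_tendsto`).
-/

namespace BanachSGD

/-! ### Duality maps and the Bregman distance -/

section Duality

variable {X : Type*} [NormedAddCommGroup X] [NormedSpace ℝ X] {p q : ℝ}

theorem dualityMap_nonempty (hp : 1 < p) (x : X) : ∃ ξ, ξ ∈ dualityMap p x := by
  rcases eq_or_ne x 0 with rfl | hx
  · exact ⟨0, by simp [dualityMap, Real.zero_rpow (sub_pos.2 hp).ne']⟩
  · obtain ⟨g, hg, hgx⟩ := exists_dual_vector ℝ x (norm_ne_zero_iff.2 hx)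
    have hpow : 0 ≤ ‖x‖ ^ (p - 1) := by positivity
    refine ⟨‖x‖ ^ (p - 1) • g, ?_, ?_⟩
    · simp only [FunLike.coe_smul, Pi.smul_apply, smul_eq_mul, norm_smul, hg, hgx,
        Real.norm_of_nonneg hpow, RCLike.ofReal_real_eq_id, id]
      ring
    · rw [norm_smul, hg, Real.norm_of_nonneg hpow, mul_one]

theorem J_mem_dualityMap (hp : 1 < p) (x : X) : J p x ∈ dualityMap p x :=
  Classical.epsilon_spec (dualityMap_nonempty hp x)

theorem norm_of_mem_dualityMap {x : X} {ξ : StrongDual ℝ X} (h : ξ ∈ dualityMap p x) :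
    ‖ξ‖ = ‖x‖ ^ (p - 1) := h.2.symm

theorem apply_self_of_mem_dualityMap (hp : 1 < p) {x : X} {ξ : StrongDual ℝ X}
    (h : ξ ∈ dualityMap p x) : ξ x = ‖x‖ ^ p := by
  have h1 := h.1
  rw [← h.2] at h1
  rw [h1, ← Real.rpow_one_add' (norm_nonneg x) (by linarith)]
  congr 1
  ring

theorem norm_J (hp : 1 < p) (x : X) : ‖J p x‖ = ‖x‖ ^ (p - 1) :=
  norm_of_mem_dualityMap (J_mem_dualityMap hp x)

theorem J_apply_self (hp : 1 < p) (x : X) : J p x x = ‖x‖ ^ p :=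
  apply_self_of_mem_dualityMap hp (J_mem_dualityMap hp x)

theorem IsSmooth.dualityMap_unique (hX : IsSmooth X) (hp : 1 < p) {x : X}
    {ξ η : StrongDual ℝ X} (hξ : ξ ∈ dualityMap p x) (hη : η ∈ dualityMap p x) : ξ = η := by
  rcases eq_or_ne x 0 with rfl | hx
  · have h0 : ∀ ζ ∈ dualityMap p (0 : X), ζ = 0 := fun ζ hζ => by
      rw [← norm_eq_zero, norm_of_mem_dualityMap hζ, norm_zero,
        Real.zero_rpow (sub_pos.2 hp).ne']
    rw [h0 ξ hξ, h0 η hη]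
  · have hpos : 0 < ‖x‖ ^ (p - 1) := Real.rpow_pos_of_pos (norm_pos_iff.2 hx) _
    have key : ∀ ζ ∈ dualityMap p x,
        ((‖x‖ ^ (p - 1))⁻¹ • ζ) x = ‖x‖ ∧ ‖(‖x‖ ^ (p - 1))⁻¹ • ζ‖ = 1 := fun ζ hζ => by
      have hn := norm_of_mem_dualityMap hζ
      constructor
      · rw [FunLike.coe_smul, Pi.smul_apply, smul_eq_mul, hζ.1, hn]
        field_simp
      · rw [norm_smul, norm_inv, Real.norm_of_nonneg hpos.le, hn]
        field_simp
    have := (hX x hx).unique (key ξ hξ) (key η hη)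
    exact smul_right_injective _ (inv_ne_zero hpos.ne') this

/-- Any element of `J_p z` is a subgradient at `z` of the convex function `‖·‖ ^ p / p`. -/
theorem subgradient_of_mem_dualityMap (hpq : p.HolderConjugate q) {z : X} {ξ : StrongDual ℝ X}
    (h : ξ ∈ dualityMap p z) (w : X) :
    1 / p * ‖z‖ ^ p + ξ (w - z) ≤ 1 / p * ‖w‖ ^ p := by
  have h1 : ξ w ≤ ‖z‖ ^ (p - 1) * ‖w‖ := by
    rw [← norm_of_mem_dualityMap h]
    exact (le_abs_self _).trans (ξ.le_opNorm w)
  have h2 := Real.young_inequality_of_nonneg (a := ‖w‖) (b := ‖z‖ ^ (p - 1)) (norm_nonneg _)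
    (by positivity) hpq
  rw [← Real.rpow_mul (norm_nonneg z), hpq.sub_one_mul_conj] at h2
  have h3 : 1 / p + 1 / q = 1 := by simpa using hpq.inv_add_inv_eq_one
  have h4 : 1 / p * ‖z‖ ^ p + 1 / q * ‖z‖ ^ p = ‖z‖ ^ p := by rw [← add_mul, h3, one_mul]
  rw [map_sub, apply_self_of_mem_dualityMap hpq.lt h]
  rw [div_eq_mul_one_div, div_eq_mul_one_div (‖z‖ ^ p)] at h2
  linarith

theorem bregman_eq (hpq : p.HolderConjugate q) (z w : X) :
    bregman p q z w = 1 / p * ‖w‖ ^ p - 1 / p * ‖z‖ ^ p - J p z (w - z) := by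
  have h3 : 1 / p + 1 / q = 1 := by simpa using hpq.inv_add_inv_eq_one
  have h4 : 1 / p * ‖z‖ ^ p + 1 / q * ‖z‖ ^ p = ‖z‖ ^ p := by rw [← add_mul, h3, one_mul]
  rw [bregman, map_sub, J_apply_self hpq.lt]
  linarith

theorem bregman_nonneg (hpq : p.HolderConjugate q) (z w : X) : 0 ≤ bregman p q z w := by
  have := subgradient_of_mem_dualityMap hpq (J_mem_dualityMap hpq.lt z) w
  rw [bregman_eq hpq]
  linarith

theorem bregman_self (hpq : p.HolderConjugate q) (z : X) : bregman p q z z = 0 := by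
  simp [bregman_eq hpq]

/-- The three-point identity of the Bregman distance. -/
theorem bregman_three_point (hpq : p.HolderConjugate q) (z w v : X) :
    bregman p q z w = bregman p q z v - bregman p q w v + (J p w - J p z) (w - v) := by
  simp only [bregman_eq hpq, FunLike.coe_sub, Pi.sub_apply, map_sub]
  ring

theorem bregman_add_swap (hpq : p.HolderConjugate q) (z w : X) :
    bregman p q z w + bregman p q w z = (J p z - J p w) (z - w) := by
  simp only [bregman_eq hpq, FunLike.coe_sub, Pi.sub_apply, map_sub]
  ring

/-- No continuity of the duality map is needed here: the symmetrized Bregman distance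
`⟨J_p x - J_p z, x - z⟩` dominates `D(x, z)` and is at most
`(‖x‖ ^ (p - 1) + ‖z‖ ^ (p - 1)) ‖x - z‖`. -/
theorem tendsto_bregman_zero (hpq : p.HolderConjugate q) {x : ℕ → X} {z : X}
    (hx : Tendsto x atTop (𝓝 z)) : Tendsto (fun k => bregman p q (x k) z) atTop (𝓝 0) := by
  have hlim : Tendsto (fun k => (‖x k‖ ^ (p - 1) + ‖z‖ ^ (p - 1)) * ‖x k - z‖) atTop (𝓝 0) := by
    have h1 : Tendsto (fun k => ‖x k‖ ^ (p - 1)) atTop (𝓝 (‖z‖ ^ (p - 1))) :=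
      hx.norm.rpow_const (Or.inr (sub_pos.2 hpq.lt).le)
    have h2 : Tendsto (fun k => ‖x k - z‖) atTop (𝓝 0) := by
      simpa using (hx.sub_const z).norm
    simpa using (h1.add_const (‖z‖ ^ (p - 1))).mul h2
  refine squeeze_zero (fun k => bregman_nonneg hpq _ _) (fun k => ?_) hlim
  have h1 := bregman_add_swap hpq (x k) z
  have h2 := bregman_nonneg hpq z (x k)
  have h3 : (J p (x k) - J p z) (x k - z) ≤ ‖J p (x k) - J p z‖ * ‖x k - z‖ :=
    (le_abs_self _).trans ((J p (x k) - J p z).le_opNorm _)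
  have h4 : ‖J p (x k) - J p z‖ ≤ ‖x k‖ ^ (p - 1) + ‖z‖ ^ (p - 1) := by
    rw [← norm_J hpq.lt, ← norm_J hpq.lt]
    exact norm_sub_le _ _
  have h5 := mul_le_mul_of_nonneg_right h4 (norm_nonneg (x k - z))
  linarith

end Duality

/-! ### Convexity of power type -/

section Convexity

variable {X : Type*} [NormedAddCommGroup X] [NormedSpace ℝ X] {p q : ℝ}

theorem IsPConvex.exists_unit_bound (hX : IsPConvex X p) (hp : 0 < p) :
    ∃ K : ℝ, 0 < K ∧ ∀ u v : X, ‖u‖ = 1 → ‖v‖ = 1 →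
      K * ‖u - v‖ ^ p ≤ 1 - 1 / 2 * ‖u + v‖ := by
  obtain ⟨K, hK, h⟩ := hX
  refine ⟨K, hK, fun u v hu hv => ?_⟩
  have hadd : ‖u + v‖ ≤ 2 := (norm_add_le u v).trans (by linarith)
  rcases eq_or_ne u v with rfl | huv
  · simp only [sub_self, norm_zero, Real.zero_rpow hp.ne', mul_zero]
    linarith
  · have h1 := h ‖u - v‖ (norm_pos_iff.2 (sub_ne_zero.2 huv))
      ((norm_sub_le u v).trans (by linarith))
    have h2 : modulusOfConvexity X ‖u - v‖ ≤ ((1 - (1 / 2) * ‖u + v‖ : ℝ) : EReal) :=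
      sInf_le ⟨u, v, hu, hv, le_rfl, rfl⟩
    exact EReal.coe_le_coe_iff.1 (h1.trans h2)

/-- Passing from unit vectors to arbitrary nonzero vectors in the definition of convexity. -/
theorem IsPConvex.exists_norm_add_le (hX : IsPConvex X p) (hp : 0 < p) :
    ∃ K : ℝ, 0 < K ∧ ∀ a b : X, a ≠ 0 → b ≠ 0 → ‖b‖ ≤ ‖a‖ →
      ‖a + b‖ ≤ ‖a‖ + ‖b‖ - 2 * K * ‖b‖ * ‖‖a‖⁻¹ • a - ‖b‖⁻¹ • b‖ ^ p := by
  obtain ⟨K, hK, h⟩ := hX.exists_unit_bound hp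
  refine ⟨K, hK, fun a b ha hb hab => ?_⟩
  have ha' : ‖a‖ ≠ 0 := norm_ne_zero_iff.2 ha
  have hb' : ‖b‖ ≠ 0 := norm_ne_zero_iff.2 hb
  have hu : ‖‖a‖⁻¹ • a‖ = 1 := by rw [norm_smul, norm_inv, norm_norm, inv_mul_cancel₀ ha']
  have hv : ‖‖b‖⁻¹ • b‖ = 1 := by rw [norm_smul, norm_inv, norm_norm, inv_mul_cancel₀ hb']
  have h1 := h _ _ hu hv
  have h2 : a + b = ‖b‖ • (‖a‖⁻¹ • a + ‖b‖⁻¹ • b) + (‖a‖ - ‖b‖) • (‖a‖⁻¹ • a) := by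
    rw [smul_add, smul_smul ‖b‖ ‖b‖⁻¹, mul_inv_cancel₀ hb', one_smul, sub_smul,
      smul_smul ‖a‖ ‖a‖⁻¹, mul_inv_cancel₀ ha', one_smul]
    abel
  have h3 : ‖a + b‖ ≤ ‖b‖ * ‖‖a‖⁻¹ • a + ‖b‖⁻¹ • b‖ + (‖a‖ - ‖b‖) := by
    conv_lhs => rw [h2]
    refine (norm_add_le _ _).trans_eq ?_
    rw [norm_smul, norm_smul (‖a‖ - ‖b‖), hu, norm_norm, Real.norm_of_nonneg (sub_nonneg.2 hab),
      mul_one]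
  nlinarith [mul_le_mul_of_nonneg_left h1 (norm_nonneg b)]

theorem IsPConvex.mono {p' : ℝ} (hX : IsPConvex X p) (h : p ≤ p') : IsPConvex X p' := by
  obtain ⟨K, hK, hKX⟩ := hX
  refine ⟨K * 2 ^ (p - p'), by positivity, fun τ h0 h2 => le_trans ?_ (hKX τ h0 h2)⟩
  refine EReal.coe_le_coe_iff.2 ?_
  have h3 : (2 : ℝ) ^ (p - p') ≤ τ ^ (p - p') :=
    Real.rpow_le_rpow_of_nonpos h0 h2 (sub_nonpos.2 h)
  calc K * 2 ^ (p - p') * τ ^ p' ≤ K * τ ^ (p - p') * τ ^ p' := by gcongr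
    _ = K * τ ^ p := by rw [mul_assoc, ← Real.rpow_add h0, sub_add_cancel]

/-- Clarkson's inequality for two real numbers. -/
theorem clarkson_real (hp : 2 ≤ p) {a b : ℝ} (hb : 0 ≤ b) (hab : b ≤ a) :
    ((a + b) / 2) ^ p + ((a - b) / 2) ^ p ≤ (a ^ p + b ^ p) / 2 := by
  have ha : 0 ≤ a := hb.trans hab
  have hsq : ∀ t : ℝ, 0 ≤ t → t ^ p = (t ^ 2) ^ (p / 2) := fun t ht => by
    rw [← Real.rpow_natCast, ← Real.rpow_mul ht]
    congr 1
    push_cast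
    ring
  have hp' : 1 ≤ p / 2 := by linarith
  have h1 : ((((a + b) / 2) ^ 2) ^ (p / 2) + (((a - b) / 2) ^ 2) ^ (p / 2)) ≤
      (((a + b) / 2) ^ 2 + ((a - b) / 2) ^ 2) ^ (p / 2) :=
    Real.add_rpow_le_rpow_add (sq_nonneg _) (sq_nonneg _) hp'
  have h2 := (convexOn_rpow hp').2 (Set.mem_Ici.2 (sq_nonneg a)) (Set.mem_Ici.2 (sq_nonneg b))
    (by norm_num : (0 : ℝ) ≤ 1 / 2) (by norm_num : (0 : ℝ) ≤ 1 / 2) (by norm_num)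
  rw [hsq _ (by linarith : 0 ≤ (a + b) / 2), hsq _ (by linarith : 0 ≤ (a - b) / 2),
    hsq a ha, hsq b hb]
  simp only [smul_eq_mul] at h2
  refine h1.trans (le_trans (le_of_eq ?_) (h2.trans (le_of_eq ?_)))
  · congr 1
    ring
  · ring

/-- For `p ≥ 2` a `p`-convex norm satisfies a quantitative midpoint convexity inequality in
the whole space. The difference of two vectors splits into a radial and an angular part; the
former is controlled by Clarkson's inequality for reals, the latter by the modulus of
convexity. -/
theorem IsPConvex.exists_midpoint (hX : IsPConvex X p) (hp : 2 ≤ p) :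
    ∃ c : ℝ, 0 < c ∧ ∀ a b : X,
      ‖(1 / 2 : ℝ) • (a + b)‖ ^ p ≤ (‖a‖ ^ p + ‖b‖ ^ p) / 2 - c * ‖a - b‖ ^ p := by
  obtain ⟨K, hK, h⟩ := hX.exists_norm_add_le (by linarith)
  have hp0 : 0 < p := by linarith
  -- The factor `2 ^ (p - 1)` pays for splitting the `p`-th power of the sum of the two parts.
  set c : ℝ := min ((1 / 2) ^ p) K / 2 ^ (p - 1) with hc
  have hc0 : 0 < c := by positivity
  have hmain : ∀ a b : X, ‖b‖ ≤ ‖a‖ →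
      ‖(1 / 2 : ℝ) • (a + b)‖ ^ p ≤ (‖a‖ ^ p + ‖b‖ ^ p) / 2 - c * ‖a - b‖ ^ p := by
    intro a b hab
    have hcl := clarkson_real hp (norm_nonneg b) hab
    have hhalf : ((‖a‖ - ‖b‖) / 2) ^ p = (1 / 2) ^ p * (‖a‖ - ‖b‖) ^ p := by
      rw [div_eq_mul_one_div, Real.mul_rpow (sub_nonneg.2 hab) (by norm_num), mul_comm]
    have hnorm : ‖(1 / 2 : ℝ) • (a + b)‖ = ‖a + b‖ / 2 := by
      rw [norm_smul, Real.norm_of_nonneg (by norm_num)]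
      ring
    have hc1 : c * 2 ^ (p - 1) ≤ (1 / 2) ^ p := by
      rw [hc, div_mul_cancel₀ _ (by positivity)]
      exact min_le_left _ _
    have hc2 : c * 2 ^ (p - 1) ≤ K := by
      rw [hc, div_mul_cancel₀ _ (by positivity)]
      exact min_le_right _ _
    rcases eq_or_ne b 0 with rfl | hb
    · have h1 : (1 : ℝ) ≤ 2 ^ (p - 1) := Real.one_le_rpow (by norm_num) (by linarith)
      have h2 : c ≤ (1 / 2) ^ p := (le_mul_of_one_le_right hc0.le h1).trans hc1
      have h3 := mul_le_mul_of_nonneg_right h2 (Real.rpow_nonneg (norm_nonneg a) p)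
      rw [hnorm]
      simp only [add_zero, sub_zero, norm_zero] at hcl hhalf ⊢
      rw [hhalf] at hcl ⊢
      linarith
    have ha : a ≠ 0 := norm_ne_zero_iff.1 ((norm_pos_iff.2 hb).trans_le hab).ne'
    have hb' : 0 < ‖b‖ := norm_pos_iff.2 hb
    have ha' : 0 < ‖a‖ := norm_pos_iff.2 ha
    have h1 := h a b ha hb hab
    set s := ‖‖a‖⁻¹ • a - ‖b‖⁻¹ • b‖ with hs
    have hs0 : 0 ≤ s := norm_nonneg _
    set M := (‖a‖ + ‖b‖) / 2 with hM
    have hM0 : 0 < M := by positivity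
    have hMb : ‖b‖ ≤ M := by linarith
    set δ := K * ‖b‖ * s ^ p with hδ
    have hδ0 : 0 ≤ δ := by positivity
    have h2 : ‖a + b‖ / 2 ≤ M - δ := by linarith
    have hδM : δ ≤ M := by linarith [norm_nonneg (a + b)]
    have h3 : (M - δ) ^ p ≤ M ^ p - δ * M ^ (p - 1) := by
      have e1 : M - δ = M * (1 - δ / M) := by field_simp
      have e2 : M ^ p = M ^ (p - 1) * M := by
        rw [← Real.rpow_add_one hM0.ne', sub_add_cancel]
      have e3 : 0 ≤ 1 - δ / M := sub_nonneg.2 ((div_le_one hM0).2 hδM)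
      have e4 : (1 - δ / M) ^ p ≤ 1 - δ / M := by
        have := Real.rpow_le_rpow_of_exponent_ge' e3 (by linarith [div_nonneg hδ0 hM0.le])
          zero_le_one (by linarith : (1 : ℝ) ≤ p)
        simpa using this
      rw [e1, Real.mul_rpow hM0.le e3]
      calc M ^ p * (1 - δ / M) ^ p ≤ M ^ p * (1 - δ / M) := by gcongr
        _ = M ^ p - δ * M ^ (p - 1) := by rw [e2]; field_simp
    have h4 : K * (‖b‖ * s) ^ p ≤ δ * M ^ (p - 1) := by
      rw [Real.mul_rpow hb'.le hs0, hδ]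
      have : ‖b‖ ^ p = ‖b‖ ^ (p - 1) * ‖b‖ := by
        rw [← Real.rpow_add_one hb'.ne', sub_add_cancel]
      rw [this]
      have h5 : ‖b‖ ^ (p - 1) ≤ M ^ (p - 1) :=
        Real.rpow_le_rpow hb'.le hMb (by linarith)
      have := mul_le_mul_of_nonneg_left h5 hδ0
      rw [hδ] at this
      linarith
    have h6 : ‖a - b‖ ≤ (‖a‖ - ‖b‖) + ‖b‖ * s := by
      have e : a - b = (‖a‖ - ‖b‖) • (‖a‖⁻¹ • a) + ‖b‖ • (‖a‖⁻¹ • a - ‖b‖⁻¹ • b) := by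
        rw [smul_sub, sub_smul, smul_smul ‖a‖ ‖a‖⁻¹, smul_smul ‖b‖ ‖b‖⁻¹,
          mul_inv_cancel₀ ha'.ne', mul_inv_cancel₀ hb'.ne', one_smul, one_smul]
        abel
      rw [e]
      refine (norm_add_le _ _).trans_eq ?_
      rw [norm_smul, norm_smul ‖b‖, norm_norm, norm_smul, norm_inv, norm_norm,
        inv_mul_cancel₀ ha'.ne', Real.norm_of_nonneg (sub_nonneg.2 hab), mul_one]
    have h7 : ‖a - b‖ ^ p ≤ 2 ^ (p - 1) * ((‖a‖ - ‖b‖) ^ p + (‖b‖ * s) ^ p) :=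
      (Real.rpow_le_rpow (norm_nonneg _) h6 hp0.le).trans <| mod_cast
        NNReal.rpow_add_le_mul_rpow_add_rpow ⟨_, sub_nonneg.2 hab⟩
          ⟨‖b‖ * s, by positivity⟩ (by linarith)
    have h8 : (‖a + b‖ / 2) ^ p ≤ (M - δ) ^ p :=
      Real.rpow_le_rpow (by positivity) h2 hp0.le
    have h9 := mul_le_mul_of_nonneg_left h7 hc0.le
    have hA : 0 ≤ (‖a‖ - ‖b‖) ^ p := Real.rpow_nonneg (sub_nonneg.2 hab) p
    have hB : 0 ≤ (‖b‖ * s) ^ p := by positivity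
    rw [hnorm]
    rw [hhalf] at hcl
    have h10 := mul_le_mul_of_nonneg_right hc1 hA
    have h11 := mul_le_mul_of_nonneg_right hc2 hB
    have h12 : c * (2 ^ (p - 1) * ((‖a‖ - ‖b‖) ^ p + (‖b‖ * s) ^ p)) =
      c * 2 ^ (p - 1) * (‖a‖ - ‖b‖) ^ p + c * 2 ^ (p - 1) * (‖b‖ * s) ^ p := by ring
    linarith
  refine ⟨c, hc0, fun a b => ?_⟩
  rcases le_total ‖b‖ ‖a‖ with hab | hab
  · exact hmain a b hab
  · have := hmain b a hab
    rw [add_comm b a, norm_sub_rev b a] at this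
    linarith

/-- In a `p`-convex space with `p ≥ 2` the Bregman distance dominates the `p`-th power of the
norm distance. -/
theorem IsPConvex.exists_bregman_ge (hX : IsPConvex X p) (hpq : p.HolderConjugate q)
    (hp : 2 ≤ p) :
    ∃ c : ℝ, 0 < c ∧ ∀ z w : X, c * ‖z - w‖ ^ p ≤ bregman p q z w := by
  obtain ⟨c, hc, h⟩ := hX.exists_midpoint hp
  have hp0 : 0 < p := hpq.pos
  refine ⟨2 / p * c, by positivity, fun z w => ?_⟩
  have h1 := subgradient_of_mem_dualityMap hpq (J_mem_dualityMap hpq.lt z)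
    ((1 / 2 : ℝ) • (z + w))
  have h2 : (1 / 2 : ℝ) • (z + w) - z = (1 / 2 : ℝ) • (w - z) := by
    module
  rw [h2, map_smul, smul_eq_mul] at h1
  have h3 := mul_le_mul_of_nonneg_left (h z w) (by positivity : 0 ≤ 1 / p)
  rw [bregman_eq hpq]
  have h4 : 1 / p * ((‖z‖ ^ p + ‖w‖ ^ p) / 2 - c * ‖z - w‖ ^ p) =
    (1 / p * ‖z‖ ^ p + 1 / p * ‖w‖ ^ p) / 2 - 2 / p * c * ‖z - w‖ ^ p / 2 := by ring
  linarith

/-- A nonempty closed convex subset of a `p`-convex Banach space has exactly one element of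
minimal norm. -/
theorem IsPConvex.existsUnique_min_norm [CompleteSpace X] (hX : IsPConvex X p) {S : Set X}
    (hne : S.Nonempty) (hcl : IsClosed S) (hconv : Convex ℝ S) :
    ∃! x, x ∈ S ∧ ∀ z ∈ S, ‖x‖ ≤ ‖z‖ := by
  -- Convexity of power type passes to larger exponents, so no lower bound on `p` is needed.
  set r := max p 2 with hr
  have hr0 : 0 < r := lt_of_lt_of_le two_pos (le_max_right _ _)
  obtain ⟨c, hc, h⟩ := (hX.mono (le_max_left p 2)).exists_midpoint (le_max_right p 2)
  rw [← hr] at h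
  set d := sInf (norm '' S) with hd
  have hbdd : BddBelow (norm '' S) := ⟨0, by rintro _ ⟨z, -, rfl⟩; exact norm_nonneg z⟩
  have hdle : ∀ z ∈ S, d ≤ ‖z‖ := fun z hz => csInf_le hbdd ⟨z, hz, rfl⟩
  have hd0 : 0 ≤ d := le_csInf (hne.image _) (by rintro _ ⟨z, -, rfl⟩; exact norm_nonneg z)
  have hmid : ∀ a ∈ S, ∀ b ∈ S, c * ‖a - b‖ ^ r ≤ (‖a‖ ^ r + ‖b‖ ^ r) / 2 - d ^ r := by
    intro a ha b hb
    have h1 : (1 / 2 : ℝ) • (a + b) ∈ S := by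
      rw [smul_add]
      exact hconv ha hb (by norm_num) (by norm_num) (by norm_num)
    have h2 := Real.rpow_le_rpow hd0 (hdle _ h1) hr0.le
    linarith [h a b]
  have hseq : ∃ x : ℕ → X, (∀ n, x n ∈ S) ∧ Tendsto (fun n => ‖x n‖) atTop (𝓝 d) := by
    obtain ⟨u, -, hu, hmem⟩ := exists_seq_tendsto_sInf (hne.image norm) hbdd
    choose x hxS hxu using hmem
    exact ⟨x, hxS, by simpa [hxu] using hu⟩
  obtain ⟨x, hxS, hx⟩ := hseq
  have hpow : Tendsto (fun n => ‖x n‖ ^ r) atTop (𝓝 (d ^ r)) :=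
    hx.rpow_const (Or.inr hr0.le)
  have hcau : CauchySeq x := by
    rw [Metric.cauchySeq_iff]
    intro ε hε
    have hδ : 0 < c * ε ^ r := by positivity
    obtain ⟨n₀, hn₀⟩ := eventually_atTop.1 (hpow.eventually (gt_mem_nhds
      (lt_add_of_pos_right (d ^ r) hδ)))
    refine ⟨n₀, fun m hm n hn => ?_⟩
    have h1 := hmid _ (hxS m) _ (hxS n)
    have h2 := hn₀ m hm
    have h3 := hn₀ n hn
    have h4 : c * ‖x m - x n‖ ^ r < c * ε ^ r := by linarith
    rw [dist_eq_norm]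
    exact (Real.rpow_lt_rpow_iff (norm_nonneg _) hε.le hr0).1 (lt_of_mul_lt_mul_left h4 hc.le)
  obtain ⟨z, hz⟩ := cauchySeq_tendsto_of_complete hcau
  have hzd : ‖z‖ = d := tendsto_nhds_unique hz.norm hx
  refine ⟨z, ⟨hcl.mem_of_tendsto hz (Eventually.of_forall hxS), fun w hw => ?_⟩, ?_⟩
  · exact hzd ▸ hdle w hw
  · rintro w ⟨hwS, hw⟩
    have hzS : z ∈ S := hcl.mem_of_tendsto hz (Eventually.of_forall hxS)
    have hwd : ‖w‖ = d := le_antisymm (hzd ▸ hw z hzS) (hdle w hwS)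
    have h1 := hmid _ hwS _ hzS
    rw [hwd, hzd] at h1
    have h2 : ‖w - z‖ ^ r ≤ 0 := by
      refine nonpos_of_mul_nonpos_right (a := c) ?_ hc
      linarith
    have h3 : ‖w - z‖ ^ r = 0 := le_antisymm h2 (by positivity)
    rw [Real.rpow_eq_zero (norm_nonneg _) hr0.ne', norm_eq_zero, sub_eq_zero] at h3
    exact h3

theorem isMinNormSolution_iff {Z : Type*} [NormedAddCommGroup Z] [NormedSpace ℝ Z]
    {A : X →L[ℝ] Z} {y : Z} {x : X} :
    IsMinNormSolution A y x ↔ A x = y ∧ ∀ z, A z = y → ‖x‖ ≤ ‖z‖ := by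
  have hbdd : BddBelow {t : ℝ | ∃ z : X, A z = y ∧ t = ‖z‖} :=
    ⟨0, by rintro _ ⟨z, -, rfl⟩; exact norm_nonneg z⟩
  constructor
  · rintro ⟨h1, h2⟩
    exact ⟨h1, fun z hz => h2.trans_le (csInf_le hbdd ⟨z, hz, rfl⟩)⟩
  · rintro ⟨h1, h2⟩
    refine ⟨h1, le_antisymm (le_csInf ⟨_, x, h1, rfl⟩ ?_) (csInf_le hbdd ⟨x, h1, rfl⟩)⟩
    rintro _ ⟨z, hz, rfl⟩
    exact h2 z hz

theorem existsUnique_isMinNormSolution [CompleteSpace X] (hX : IsPConvex X p)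
    {Z : Type*} [NormedAddCommGroup Z] [NormedSpace ℝ Z] (A : X →L[ℝ] Z) {y : Z}
    (hy : y ∈ Set.range A) : ∃! x, IsMinNormSolution A y x := by
  simp only [isMinNormSolution_iff]
  exact hX.existsUnique_min_norm (S := A ⁻¹' {y}) hy
    (isClosed_singleton.preimage A.continuous)
    ((convex_singleton y).is_linear_preimage A.isLinear)

/-- Every functional attains its norm, at a multiple of the element of minimal norm in
`{x | ξ x = 1}`; hence the duality map of the dual has a value in `X` itself. -/
theorem exists_mem_dualityMap_dual [CompleteSpace X] (hX : IsPConvex X p)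
    (hq : 1 < q) (ξ : StrongDual ℝ X) :
    ∃ x : X, NormedSpace.inclusionInDoubleDual ℝ X x ∈ dualityMap q ξ := by
  have hnorm : ∀ x : X, ‖NormedSpace.inclusionInDoubleDual ℝ X x‖ = ‖x‖ := fun x =>
    (NormedSpace.inclusionInDoubleDualLi ℝ).norm_map x
  rcases eq_or_ne ξ 0 with rfl | hξ
  · exact ⟨0, by simp [dualityMap, Real.zero_rpow (sub_pos.2 hq).ne']⟩
  have hξ' : 0 < ‖ξ‖ := norm_pos_iff.2 hξ
  obtain ⟨v, hv⟩ : ∃ v, ξ v ≠ 0 := by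
    by_contra! h
    exact hξ (ContinuousLinearMap.ext h)
  have hne : (ξ ⁻¹' {1}).Nonempty := ⟨(ξ v)⁻¹ • v, by simp [hv]⟩
  obtain ⟨x, ⟨hx1, hx2⟩, -⟩ := hX.existsUnique_min_norm hne
    (isClosed_singleton.preimage ξ.continuous)
    ((convex_singleton (1 : ℝ)).is_linear_preimage ξ.isLinear)
  have hx1' : ξ x = 1 := hx1
  have hx0 : 0 < ‖x‖ := norm_pos_iff.2 fun h => by simp [h] at hx1'
  have hle : ‖ξ‖ ≤ ‖x‖⁻¹ := by
    refine ξ.opNorm_le_bound (by positivity) fun w => ?_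
    rcases eq_or_ne (ξ w) 0 with hw | hw
    · rw [hw, norm_zero]
      positivity
    · have h1 := hx2 ((ξ w)⁻¹ • w) (by simp [hw])
      rw [norm_smul, norm_inv] at h1
      have h2 : 0 < ‖ξ w‖ := norm_pos_iff.2 hw
      rw [inv_mul_eq_div, le_div_iff₀ h2] at h1
      rw [inv_mul_eq_div, le_div_iff₀ hx0]
      linarith
  have hge : 1 ≤ ‖ξ‖ * ‖x‖ := by
    have := ξ.le_opNorm x
    rwa [hx1', norm_one] at this
  have hprod : ‖ξ‖ * ‖x‖ = 1 :=
    le_antisymm (by simpa [hx0.ne'] using mul_le_mul_of_nonneg_right hle hx0.le) hge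
  have hqpos : 0 < ‖ξ‖ ^ q := Real.rpow_pos_of_pos hξ' q
  have hpow : ‖ξ‖ ^ q = ‖ξ‖ ^ (q - 1) * ‖ξ‖ := by
    rw [← Real.rpow_add_one hξ'.ne', sub_add_cancel]
  have hn : ‖‖ξ‖ ^ q • x‖ = ‖ξ‖ ^ (q - 1) := by
    rw [norm_smul, Real.norm_of_nonneg hqpos.le, hpow, mul_assoc, hprod, mul_one]
  refine ⟨‖ξ‖ ^ q • x, ?_, ?_⟩
  · rw [hnorm, hn, NormedSpace.dual_def, map_smul, hx1', smul_eq_mul, mul_one, hpow, mul_comm]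
  · rw [hnorm, hn]

/-- On a smooth `p`-convex Banach space the map `Jstar q` is a right inverse of `J p`. -/
theorem J_Jstar [CompleteSpace X] (hX : IsPConvex X p) (hs : IsSmooth X)
    (hpq : p.HolderConjugate q) (ξ : StrongDual ℝ X) : J p (Jstar q ξ) = ξ := by
  have h : NormedSpace.inclusionInDoubleDual ℝ X (Jstar q ξ) ∈ dualityMap q ξ :=
    Classical.epsilon_spec (exists_mem_dualityMap_dual hX hpq.symm.lt ξ)
  have hnorm : ‖NormedSpace.inclusionInDoubleDual ℝ X (Jstar q ξ)‖ = ‖Jstar q ξ‖ :=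
    (NormedSpace.inclusionInDoubleDualLi ℝ).norm_map _
  have h1 := h.1
  have h2 := h.2
  rw [hnorm, NormedSpace.dual_def] at h1
  rw [hnorm] at h2
  refine hs.dualityMap_unique hpq.lt (J_mem_dualityMap hpq.lt _) ⟨by rw [h1, mul_comm], ?_⟩
  rw [← h2, ← Real.rpow_mul (norm_nonneg ξ)]
  have : (q - 1) * (p - 1) = 1 := by
    have := hpq.mul_eq_add
    linarith
  rw [this, Real.rpow_one]

end Convexity

/-! ### Sums along independent random indices -/

section Random

variable {Ω ι : Type*} {ζ : ℕ → Ω → ι}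

theorem exists_eq_comp_of_determined {k : ℕ} {f : Ω → ℝ}
    (hf : ∀ ω ω', (∀ m < k, ζ m ω = ζ m ω') → f ω = f ω') :
    ∃ h : (Finset.range k → ι) → ℝ, f = fun ω => h (fun m => ζ m ω) := by
  have hfac : Function.FactorsThrough f (fun ω (m : Finset.range k) => ζ m ω) :=
    fun ω ω' h => hf ω ω' fun m hm => congrFun h ⟨m, Finset.mem_range.2 hm⟩
  exact ⟨Function.extend _ f fun _ => (0 : ℝ), (hfac.extend_comp _).symm⟩

theorem exists_le_of_determined [Finite ι] {k : ℕ} {f : Ω → ℝ}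
    (hf : ∀ ω ω', (∀ m < k, ζ m ω = ζ m ω') → f ω = f ω') : ∃ C, ∀ ω, f ω ≤ C := by
  obtain ⟨h, rfl⟩ := exists_eq_comp_of_determined hf
  obtain ⟨C, hC⟩ := (Set.finite_range h).bddAbove
  exact ⟨C, fun ω => hC ⟨_, rfl⟩⟩

variable [MeasurableSpace Ω] {P : Measure Ω} [Finite ι] [MeasurableSpace ι]
  [MeasurableSingletonClass ι]

open scoped Classical in
/-- Let `f k` be nonnegative and determined by the indices `ζ 0, …, ζ (k - 1)`. If the sum of
`f k` over those times `k` at which `ζ k = n` is bounded, then `∑ f k` converges almost surely: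
since `ζ k` is independent of `f k`, the expectation of the former sum is a fixed multiple of
that of the latter. -/
theorem ae_summable_of_sum_ite_le (hζ : ∀ k, Measurable (ζ k)) (hind : iIndepFun ζ P)
    {n : ι} {a : ℝ≥0∞} (ha : a ≠ 0) (hn : ∀ k, P {ω | ζ k ω = n} = a)
    {f : ℕ → Ω → ℝ} (hf0 : ∀ k ω, 0 ≤ f k ω)
    (hf : ∀ k ω ω', (∀ m < k, ζ m ω = ζ m ω') → f k ω = f k ω')
    {C : ℝ} (hC : ∀ M ω, ∑ k ∈ Finset.range M, (if ζ k ω = n then f k ω else 0) ≤ C) :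
    ∀ᵐ ω ∂P, Summable fun k => f k ω := by
  have : IsProbabilityMeasure P := hind.isProbabilityMeasure
  choose h hh using fun k => exists_eq_comp_of_determined (hf k)
  set F : ℕ → Ω → ℝ≥0∞ := fun k ω => ENNReal.ofReal (f k ω) with hF
  set I : ℕ → Ω → ℝ≥0∞ := fun k ω => if ζ k ω = n then 1 else 0 with hI
  have hpast : ∀ k, Measurable fun ω (m : Finset.range k) => ζ m ω := fun k =>
    measurable_pi_lambda _ fun m => hζ m
  have hFm : ∀ k, Measurable (F k) := fun k => by
    have : F k = (fun t => ENNReal.ofReal (h k t)) ∘ fun ω (m : Finset.range k) => ζ m ω := by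
      ext ω
      simp only [hF, Function.comp_apply]
      rw [hh k]
    rw [this]
    exact (measurable_of_finite _).comp (hpast k)
  have hIm : ∀ k, Measurable (I k) := fun k =>
    (measurable_of_finite fun t : ι => if t = n then (1 : ℝ≥0∞) else 0).comp (hζ k)
  have hindep : ∀ k, IndepFun (F k) (I k) P := fun k => by
    have h1 := hind.indepFun_finset (Finset.range k) {k} (by simp) hζ
    have h2 := h1.comp (φ := fun t => ENNReal.ofReal (h k t))
      (ψ := fun t : ({k} : Finset ℕ) → ι =>
        if t ⟨k, Finset.mem_singleton_self k⟩ = n then (1 : ℝ≥0∞) else 0)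
      (measurable_of_finite _) (measurable_of_finite _)
    convert! h2 using 1
    ext ω
    simp only [hF, Function.comp_apply]
    rw [hh k]
  have hIint : ∀ k, ∫⁻ ω, I k ω ∂P = a := fun k => by
    have : I k = {ω | ζ k ω = n}.indicator 1 := by
      ext ω
      simp [hI, Set.indicator_apply]
    rw [this, lintegral_indicator_one (measurableSet_eq_fun (hζ k) measurable_const), hn k]
  have hprod : ∀ k, ∫⁻ ω, F k ω * I k ω ∂P = (∫⁻ ω, F k ω ∂P) * a := fun k => by
    rw [← hIint k]
    exact lintegral_mul_eq_lintegral_mul_lintegral_of_indepFun (hFm k) (hIm k) (hindep k)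
  have hle : ∀ ω, ∑' k, F k ω * I k ω ≤ ENNReal.ofReal C := fun ω => by
    refine ENNReal.tsum_le_of_sum_range_le fun M => ?_
    have h1 : ∀ k, F k ω * I k ω = ENNReal.ofReal (if ζ k ω = n then f k ω else 0) := fun k => by
      simp only [hF, hI]
      split_ifs <;> simp
    simp only [h1]
    rw [← ENNReal.ofReal_sum_of_nonneg fun k _ => by split_ifs <;> simp [hf0]]
    exact ENNReal.ofReal_le_ofReal (hC M ω)
  have hsum : (∑' k, ∫⁻ ω, F k ω ∂P) * a ≤ ENNReal.ofReal C := by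
    rw [← ENNReal.tsum_mul_right]
    simp only [← hprod]
    rw [← lintegral_tsum (f := fun k ω => F k ω * I k ω)
      fun k => ((hFm k).mul (hIm k)).aemeasurable]
    calc ∫⁻ ω, ∑' k, F k ω * I k ω ∂P ≤ ∫⁻ _, ENNReal.ofReal C ∂P := lintegral_mono hle
      _ = ENNReal.ofReal C := by simp
  have hfin : ∫⁻ ω, ∑' k, F k ω ∂P ≠ ∞ := by
    rw [lintegral_tsum fun k => (hFm k).aemeasurable]
    intro htop
    rw [htop, ENNReal.top_mul ha] at hsum
    exact ENNReal.ofReal_ne_top (top_le_iff.1 hsum)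
  filter_upwards [ae_lt_top (Measurable.tsum hFm) hfin] with ω hω
  have := ENNReal.summable_toReal hω.ne
  simpa only [hF, ENNReal.toReal_ofReal (hf0 _ ω)] using this

open scoped Classical in
/-- A criterion for `∑ f k < ∞` by means of a Lyapunov function `V` which drops by at least `f k`
at all late times `k` with `ζ k = n`. -/
theorem ae_summable_of_lyapunov (hζ : ∀ k, Measurable (ζ k)) (hind : iIndepFun ζ P)
    {n : ι} {a : ℝ≥0∞} (ha : a ≠ 0) (hn : ∀ k, P {ω | ζ k ω = n} = a)
    {f V : ℕ → Ω → ℝ} (hf0 : ∀ k ω, 0 ≤ f k ω) (hV0 : ∀ k ω, 0 ≤ V k ω)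
    (hf : ∀ k ω ω', (∀ m < k, ζ m ω = ζ m ω') → f k ω = f k ω')
    (hV : ∀ k ω ω', (∀ m < k, ζ m ω = ζ m ω') → V k ω = V k ω')
    {k₀ : ℕ} (hle : ∀ k ≥ k₀, ∀ ω, V (k + 1) ω + (if ζ k ω = n then f k ω else 0) ≤ V k ω) :
    ∀ᵐ ω ∂P, Summable fun k => f k ω := by
  obtain ⟨C, hC⟩ := exists_le_of_determined (hV k₀)
  have h1 := ae_summable_of_sum_ite_le hζ hind ha hn
    (f := fun k ω => if k < k₀ then 0 else f k ω) (C := C)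
    (fun k ω => by split_ifs <;> simp [hf0])
    (fun k ω ω' h => by simp only [hf k ω ω' h]) (fun M ω => by
      have key : ∑ k ∈ Finset.range M, (if ζ k ω = n then (if k < k₀ then 0 else f k ω) else 0)
          ≤ V k₀ ω - V (max k₀ M) ω := by
        induction M with
        | zero => simp
        | succ M ih =>
          rw [Finset.sum_range_succ]
          rcases lt_or_ge M k₀ with hM | hM
          · rw [max_eq_left hM.le] at ih
            rw [max_eq_left (Nat.succ_le_of_lt hM)]
            simpa [hM] using ih
          · rw [max_eq_right hM] at ih
            rw [max_eq_right (by omega), if_neg (not_lt.2 hM)]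
            linarith [hle M hM ω]
      linarith [hC ω, hV0 (max k₀ M) ω])
  filter_upwards [h1] with ω hω
  rw [← summable_nat_add_iff k₀] at hω ⊢
  simpa using hω

open scoped Classical in
/-- A divergent series with bounded nonnegative terms almost surely still diverges when only the
terms with `ζ k = n` are kept. -/
theorem ae_not_summable_ite (hζ : ∀ k, Measurable (ζ k)) (hind : iIndepFun ζ P)
    {n : ι} {a : ℝ≥0∞} (ha : a ≠ 0) (hn : ∀ k, P {ω | ζ k ω = n} = a)
    {ν : ℕ → ℝ} (hν0 : ∀ k, 0 ≤ ν k) {b : ℝ} (hνb : ∀ k, ν k ≤ b) (hν : ¬ Summable ν) :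
    ∀ᵐ ω ∂P, ¬ Summable fun k => if ζ k ω = n then ν k else 0 := by
  set S : ℕ → Ω → ℝ := fun k ω => ∑ m ∈ Finset.range k, (if ζ m ω = n then ν m else 0) with hS
  have hSsucc : ∀ k ω, S (k + 1) ω = S k ω + (if ζ k ω = n then ν k else 0) := fun k ω =>
    Finset.sum_range_succ _ _
  -- Truncating the terms before the partial sums exceed a level `C` keeps them predictable.
  have h1 : ∀ C : ℕ, ∀ᵐ ω ∂P, Summable fun k => if S k ω + ν k ≤ C then ν k else 0 := by
    intro C
    refine ae_summable_of_sum_ite_le hζ hind ha hn (C := C)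
      (fun k ω => by split_ifs <;> simp [hν0]) (fun k ω ω' h => ?_) (fun M ω => ?_)
    · have : S k ω = S k ω' := Finset.sum_congr rfl fun m hm => by
        rw [h m (Finset.mem_range.1 hm)]
      simp only [this]
    · have key : ∑ k ∈ Finset.range M,
          (if ζ k ω = n then (if S k ω + ν k ≤ C then ν k else 0) else 0) ≤ min (S M ω) C := by
        induction M with
        | zero => simp [hS]
        | succ M ih =>
          obtain ⟨ih1, ih2⟩ := le_min_iff.1 ih
          have := hν0 M
          rw [Finset.sum_range_succ, hSsucc, le_min_iff]
          split_ifs <;> constructor <;> linarith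
      exact key.trans (min_le_right _ _)
  filter_upwards [ae_all_iff.2 h1] with ω hω hsum
  obtain ⟨C, hC⟩ := exists_nat_ge ((∑' k, if ζ k ω = n then ν k else 0) + b)
  have h2 : ∀ k, S k ω + ν k ≤ C := fun k => by
    have := hsum.sum_le_tsum (Finset.range k) fun m _ => by split_ifs <;> simp [hν0]
    have h3 := hνb k
    simp only [hS]
    linarith
  have h4 := hω C
  simp only [h2, if_true] at h4
  exact hν h4

end Random

/-! ### Numerical sequences -/

section Sequences

theorem exists_lt_of_summable_mul {ν f : ℕ → ℝ} (hν0 : ∀ k, 0 ≤ ν k)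
    (hν : ¬ Summable ν) (hνf : Summable fun k => ν k * f k) {ε : ℝ} (hε : 0 < ε) (n : ℕ) :
    ∃ k ≥ n, f k < ε := by
  by_contra! h
  refine hν ((summable_nat_add_iff n).1 ?_)
  have h1 : Summable fun k => ε⁻¹ * (ν (k + n) * f (k + n)) :=
    ((summable_nat_add_iff (f := fun k => ν k * f k) n).2 hνf).mul_left _
  refine h1.of_nonneg_of_le (fun k => hν0 _) fun k => ?_
  rw [inv_mul_eq_div, le_div_iff₀ hε]
  exact mul_le_mul_of_nonneg_left (h _ (by omega)) (hν0 _)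

/-- A positive sequence with values arbitrarily close to zero attains new minima infinitely
often. -/
theorem exists_running_min {f : ℕ → ℝ} {k₀ : ℕ} (hpos : ∀ k ≥ k₀, 0 < f k)
    (hf : ∀ ε > 0, ∀ n, ∃ k ≥ n, f k < ε) (n : ℕ) :
    ∃ l ≥ n, k₀ ≤ l ∧ ∀ m, k₀ ≤ m → m ≤ l → f l ≤ f m := by
  obtain ⟨m₀, hm₀, hmin⟩ := Finset.exists_min_image (Finset.Icc k₀ (max k₀ n)) f ⟨k₀, by simp⟩
  have hε : 0 < f m₀ := hpos _ (Finset.mem_Icc.1 hm₀).1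
  have hex : ∃ k, k₀ ≤ k ∧ f k < f m₀ := (hf _ hε k₀).imp fun k hk => ⟨hk.1, hk.2⟩
  classical
  obtain ⟨h1, h2⟩ := Nat.find_spec hex
  refine ⟨Nat.find hex, ?_, h1, fun m hm hml => ?_⟩
  · by_contra! hlt
    exact absurd (hmin _ (Finset.mem_Icc.2 ⟨h1, hlt.le.trans (le_max_right _ _)⟩)) (not_le.2 h2)
  · rcases hml.eq_or_lt with rfl | hlt
    · exact le_rfl
    · have := Nat.find_min hex hlt
      push Not at this
      exact h2.le.trans (this hm)

end Sequences

/-! ### One step of the iteration -/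

section Descent

variable {X : Type*} [NormedAddCommGroup X] [NormedSpace ℝ X]
  {N : ℕ} {Y : Fin N → Type*} [∀ i, NormedAddCommGroup (Y i)] [∀ i, NormedSpace ℝ (Y i)]
  {r : ℝ≥0∞} {p q : ℝ}
  {A : X →L[ℝ] PiLp r Y} {y : PiLp r Y} {j : ∀ i, Y i → StrongDual ℝ (Y i)}

theorem component_apply_eq {z : X} (hz : A z = y) (i : Fin N) : component A i z = y i := by
  rw [← hz]
  rfl

theorem direction_apply_sub {z : X} (hz : A z = y) (x w : X) (i : Fin N) :
    direction A y j x i (w - z) = j i (component A i x - y i) (component A i w - y i) := by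
  rw [direction, adjointMap, ContinuousLinearMap.comp_apply, map_sub (component A i),
    component_apply_eq hz]

theorem direction_apply_self (hj : ∀ i (v : Y i), j i v ∈ dualityMap p v) (hp : 1 < p)
    {z : X} (hz : A z = y) (x : X) (i : Fin N) :
    direction A y j x i (x - z) = ‖component A i x - y i‖ ^ p := by
  rw [direction_apply_sub hz, apply_self_of_mem_dualityMap hp (hj i _)]

theorem norm_direction_le (hj : ∀ i (v : Y i), j i v ∈ dualityMap p v) (x : X) (i : Fin N) :
    ‖direction A y j x i‖ ≤ ‖component A i x - y i‖ ^ (p - 1) * ‖component A i‖ := by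
  rw [← norm_of_mem_dualityMap (hj i _)]
  exact ContinuousLinearMap.opNorm_comp_le _ _

theorem exists_young_bound (hpq : p.HolderConjugate q) {c : ℝ} (hc : 0 < c) :
    ∃ C : ℝ, 0 ≤ C ∧ ∀ a t : ℝ, 0 ≤ a → 0 ≤ t → a * t ≤ c * t ^ p + C * a ^ q := by
  have hs : 0 < c ^ (1 / p) := Real.rpow_pos_of_pos hc _
  refine ⟨((c ^ (1 / p))⁻¹) ^ q, by positivity, fun a t ha ht => ?_⟩
  have h1 := Real.young_inequality_of_nonneg (a := c ^ (1 / p) * t) (b := (c ^ (1 / p))⁻¹ * a)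
    (by positivity) (by positivity) hpq
  rw [Real.mul_rpow hs.le ht, Real.mul_rpow (by positivity) ha, ← Real.rpow_mul hc.le,
    one_div_mul_cancel hpq.ne_zero, Real.rpow_one] at h1
  have h2 : c ^ (1 / p) * t * ((c ^ (1 / p))⁻¹ * a) = a * t := by field_simp
  have h3 : c * t ^ p / p ≤ c * t ^ p := div_le_self (by positivity) hpq.lt.le
  have h4 : ((c ^ (1 / p))⁻¹) ^ q * a ^ q / q ≤ ((c ^ (1 / p))⁻¹) ^ q * a ^ q :=
    div_le_self (by positivity) hpq.symm.lt.le
  linarith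

/-- One step of the iteration decreases the Bregman distance to every solution, up to a term
of order `m ^ q` in the step size `m`. The lower bound of the Bregman distance and Young's
inequality together replace the smoothness of power type of the dual norm. -/
theorem exists_bregman_step_le (hpq : p.HolderConjugate q)
    (hj : ∀ i (v : Y i), j i v ∈ dualityMap p v) {c : ℝ} (hc : 0 < c)
    (hD : ∀ z w : X, c * ‖z - w‖ ^ p ≤ bregman p q z w) :
    ∃ C : ℝ, 0 ≤ C ∧ ∀ (m : ℝ) (x x' z : X) (i : Fin N), 0 ≤ m → A z = y →
      J p x' = J p x - m • direction A y j x i →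
      bregman p q x' z ≤ bregman p q x z - m * ‖component A i x - y i‖ ^ p +
        C * m ^ q * ‖component A i x - y i‖ ^ p := by
  obtain ⟨C, hC, hyoung⟩ := exists_young_bound hpq hc
  set L := ∑ i, ‖component A i‖ with hL
  have hLi : ∀ i, ‖component A i‖ ≤ L := fun i =>
    Finset.single_le_sum (f := fun i => ‖component A i‖) (fun _ _ => norm_nonneg _)
      (Finset.mem_univ i)
  have hL0 : 0 ≤ L := Finset.sum_nonneg fun _ _ => norm_nonneg _
  refine ⟨C * L ^ q, by positivity, fun m x x' z i hm hz hJ => ?_⟩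
  set R := ‖component A i x - y i‖ with hR
  set g := direction A y j x i with hg
  have hR0 : 0 ≤ R := norm_nonneg _
  have h1 := bregman_three_point hpq x' x z
  have h2 := bregman_add_swap hpq x' x
  have h3 : J p x - J p x' = m • g := by rw [hJ]; abel
  have h4 : J p x' - J p x = -(m • g) := by rw [hJ]; abel
  have h5 : (m • g) (x - z) = m * R ^ p := by
    rw [FunLike.coe_smul, Pi.smul_apply, smul_eq_mul, hg, direction_apply_self hj hpq.lt hz]
  have h6 : (-(m • g)) (x' - x) ≤ m * (R ^ (p - 1) * L) * ‖x' - x‖ := by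
    refine (le_abs_self _).trans (((-(m • g)).le_opNorm _).trans ?_)
    rw [norm_neg, norm_smul, Real.norm_of_nonneg hm]
    have := (norm_direction_le (A := A) (y := y) hj x i).trans
      (mul_le_mul_of_nonneg_left (hLi i) (by positivity))
    gcongr
  have h7 := hyoung (m * (R ^ (p - 1) * L)) ‖x' - x‖ (by positivity) (norm_nonneg _)
  have h8 : (m * (R ^ (p - 1) * L)) ^ q = m ^ q * (R ^ p * L ^ q) := by
    rw [Real.mul_rpow hm (by positivity), Real.mul_rpow (by positivity) hL0,
      ← Real.rpow_mul hR0, hpq.sub_one_mul_conj]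
  have h9 := hD x x'
  rw [norm_sub_rev] at h9
  rw [h3, h5] at h1
  rw [h4] at h2
  rw [h8] at h7
  have h10 : C * L ^ q * m ^ q * R ^ p = C * (m ^ q * (R ^ p * L ^ q)) := by ring
  linarith

theorem tendsto_zero_of_summable_rpow (hq : 0 < q) {ν : ℕ → ℝ} (hν0 : ∀ k, 0 ≤ ν k)
    (hν : Summable fun k => ν k ^ q) : Tendsto ν atTop (𝓝 0) := by
  have h := hν.tendsto_atTop_zero.rpow_const (p := 1 / q) (Or.inr (by positivity))
  rw [Real.zero_rpow (by positivity)] at h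
  refine h.congr fun k => ?_
  rw [← Real.rpow_mul (hν0 k), mul_one_div_cancel hq.ne', Real.rpow_one]

/-- Since the step sizes tend to zero, from some time on the Bregman distance to every solution
decreases, whatever the indices are. -/
theorem exists_bregman_decrease (hpq : p.HolderConjugate q)
    (hj : ∀ i (v : Y i), j i v ∈ dualityMap p v) {c : ℝ} (hc : 0 < c)
    (hD : ∀ z w : X, c * ‖z - w‖ ^ p ≤ bregman p q z w)
    {ν : ℕ → ℝ} (hν0 : ∀ k, 0 < ν k) (hν : Summable fun k => ν k ^ q) :
    ∃ k₀, ∀ k ≥ k₀, ∀ (x x' z : X) (i : Fin N), A z = y →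
      J p x' = J p x - ν k • direction A y j x i →
      bregman p q x' z + ν k * (‖component A i x - y i‖ ^ p / 2) ≤ bregman p q x z := by
  obtain ⟨C, hC, hstep⟩ := exists_bregman_step_le (A := A) (y := y) hpq hj hc hD
  have hlim : Tendsto (fun k => C * ν k ^ (q - 1)) atTop (𝓝 0) := by
    have h := (tendsto_zero_of_summable_rpow hpq.symm.pos (fun k => (hν0 k).le) hν).rpow_const
      (p := q - 1) (Or.inr (sub_pos.2 hpq.symm.lt).le)
    rw [Real.zero_rpow (sub_pos.2 hpq.symm.lt).ne'] at h
    simpa using h.const_mul C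
  obtain ⟨k₀, hk₀⟩ := eventually_atTop.1 (hlim.eventually (gt_mem_nhds
    (by norm_num : (0 : ℝ) < 1 / 2)))
  refine ⟨k₀, fun k hk x x' z i hz hJ => ?_⟩
  have h1 := hstep (ν k) x x' z i (hν0 k).le hz hJ
  have h2 : C * ν k ^ q ≤ ν k / 2 := by
    have h3 : ν k ^ q = ν k ^ (q - 1) * ν k := by
      rw [← Real.rpow_add_one (hν0 k).ne', sub_add_cancel]
    rw [h3, ← mul_assoc]
    have := mul_le_mul_of_nonneg_right (hk₀ k hk).le (hν0 k).le
    linarith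
  have h4 := mul_le_mul_of_nonneg_right h2
    (Real.rpow_nonneg (norm_nonneg (component A i x - y i)) p)
  linarith

end Descent

/-! ### Convergence of a single trajectory when `p ≥ 2` -/

section Trajectory

variable {X : Type*} [NormedAddCommGroup X] [NormedSpace ℝ X]
  {N : ℕ} {Y : Fin N → Type*} [∀ i, NormedAddCommGroup (Y i)] [∀ i, NormedSpace ℝ (Y i)]
  {r : ℝ≥0∞} {p q : ℝ}

/-- The total residual `∑ i, ‖A_i x - y_i‖ ^ p`. -/
noncomputable def residual (p : ℝ) (A : X →L[ℝ] PiLp r Y) (y : PiLp r Y) (x : X) : ℝ :=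
  ∑ i, ‖component A i x - y i‖ ^ p

variable {A : X →L[ℝ] PiLp r Y} {y : PiLp r Y} {j : ∀ i, Y i → StrongDual ℝ (Y i)}

theorem rpow_le_residual (x : X) (i : Fin N) :
    ‖component A i x - y i‖ ^ p ≤ residual p A y x :=
  Finset.single_le_sum (f := fun i => ‖component A i x - y i‖ ^ p)
    (fun _ _ => by positivity) (Finset.mem_univ i)

theorem residual_nonneg (x : X) : 0 ≤ residual p A y x :=
  Finset.sum_nonneg fun _ _ => by positivity

theorem continuous_residual (hp : 0 < p) : Continuous (residual p A y) :=
  continuous_finsetSum _ fun i _ =>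
    (((component A i).continuous.sub continuous_const).norm).rpow_const fun _ => Or.inr hp.le

theorem eq_of_residual_eq_zero (hp : 0 < p) {x : X} (h : residual p A y x = 0) : A x = y := by
  ext i
  have h1 := (rpow_le_residual (p := p) (A := A) (y := y) x i).trans_eq h
  have h2 : ‖component A i x - y i‖ ^ p = 0 := le_antisymm h1 (by positivity)
  rw [Real.rpow_eq_zero (norm_nonneg _) hp.ne', norm_eq_zero, sub_eq_zero] at h2
  exact h2

/-- The direction taken at a point of larger residual, evaluated at the error of a point of
smaller residual. -/
theorem abs_direction_apply_sub_le (hpq : p.HolderConjugate q)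
    (hj : ∀ i (v : Y i), j i v ∈ dualityMap p v) {z : X} (hz : A z = y) {x w : X}
    (hxw : residual p A y w ≤ residual p A y x) (i : Fin N) :
    |direction A y j x i (w - z)| ≤ residual p A y x := by
  have hF := residual_nonneg (p := p) (A := A) (y := y) x
  rw [direction_apply_sub hz]
  refine ((j i _).le_opNorm _).trans ?_
  rw [norm_of_mem_dualityMap (hj i _)]
  have hroot : ∀ v : X, residual p A y v ≤ residual p A y x →
      ‖component A i v - y i‖ ≤ residual p A y x ^ (1 / p) := fun v hv => by
    have h1 := Real.rpow_le_rpow (by positivity) ((rpow_le_residual v i).trans hv)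
      (by have := hpq.pos; positivity : 0 ≤ 1 / p)
    rwa [← Real.rpow_mul (norm_nonneg _), mul_one_div_cancel hpq.ne_zero, Real.rpow_one] at h1
  calc ‖component A i x - y i‖ ^ (p - 1) * ‖component A i w - y i‖
      ≤ (residual p A y x ^ (1 / p)) ^ (p - 1) * residual p A y x ^ (1 / p) := by
        have hp1 : 0 ≤ p - 1 := (sub_pos.2 hpq.lt).le
        gcongr
        · exact hroot x le_rfl
        · exact hroot w hxw
    _ = (residual p A y x ^ (1 / p)) ^ p := by
        rw [← Real.rpow_add_one' (by positivity) (by simpa using hpq.ne_zero), sub_add_cancel]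
    _ = residual p A y x := by
        rw [← Real.rpow_mul hF, one_div_mul_cancel hpq.ne_zero, Real.rpow_one]

/-- A trajectory with summable weighted residuals converges to a solution. Along the times at
which the residual attains a new minimum, the three-point identity makes the trajectory a Cauchy
sequence; its limit is a solution, and the Bregman distance to that solution is eventually
decreasing, so the whole trajectory converges to it. -/
theorem exists_tendsto_of_summable_residual [CompleteSpace X] (hpq : p.HolderConjugate q)
    (hj : ∀ i (v : Y i), j i v ∈ dualityMap p v) {c : ℝ} (hc : 0 < c)
    (hD : ∀ z w : X, c * ‖z - w‖ ^ p ≤ bregman p q z w)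
    {ν : ℕ → ℝ} (hν0 : ∀ k, 0 < ν k) (hν : ¬ Summable ν)
    {x : ℕ → X} {s : ℕ → Fin N} {k₀ : ℕ}
    (hJ : ∀ k, J p (x (k + 1)) = J p (x k) - ν k • direction A y j (x k) (s k))
    (hanti : ∀ z, A z = y → ∀ k ≥ k₀, bregman p q (x (k + 1)) z ≤ bregman p q (x k) z)
    (hsum : Summable fun k => ν k * residual p A y (x k)) (hy : y ∈ Set.range A) :
    ∃ z, A z = y ∧ Tendsto x atTop (𝓝 z) := by
  have hp0 : 0 < p := hpq.pos
  have hanti' : ∀ z, A z = y → ∀ k ≥ k₀, ∀ l ≥ k, bregman p q (x l) z ≤ bregman p q (x k) z := by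
    intro z hz k hk l hl
    induction l, hl using Nat.le_induction with
    | base => exact le_rfl
    | succ l hl ih => exact (hanti z hz l (hk.trans hl)).trans ih
  -- It suffices that the Bregman distance to some solution becomes arbitrarily small.
  have hconc : ∀ z, A z = y → (∀ ε > 0, ∃ k ≥ k₀, bregman p q (x k) z < ε) →
      Tendsto x atTop (𝓝 z) := by
    intro z hz hsmall
    rw [Metric.tendsto_atTop]
    intro ε hε
    obtain ⟨k, hk, hkε⟩ := hsmall (c * ε ^ p) (by positivity)
    refine ⟨k, fun l hl => ?_⟩
    have h1 := ((hD (x l) z).trans (hanti' z hz k hk l hl)).trans_lt hkε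
    rw [dist_eq_norm]
    exact (Real.rpow_lt_rpow_iff (norm_nonneg _) hε.le hp0).1 (lt_of_mul_lt_mul_left h1 hc.le)
  by_cases hzero : ∃ m ≥ k₀, residual p A y (x m) = 0
  · obtain ⟨m, hm, hm0⟩ := hzero
    have hz := eq_of_residual_eq_zero hp0 hm0
    refine ⟨x m, hz, hconc _ hz fun ε hε => ⟨m, hm, ?_⟩⟩
    rwa [bregman_self hpq]
  have hpos : ∀ k ≥ k₀, 0 < residual p A y (x k) := fun k hk =>
    (residual_nonneg _).lt_of_ne fun h => hzero ⟨k, hk, h.symm⟩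
  have hsmall : ∀ ε > 0, ∀ n, ∃ k ≥ n, residual p A y (x k) < ε := fun ε hε n =>
    exists_lt_of_summable_mul (fun k => (hν0 k).le) hν hsum hε n
  obtain ⟨φ, hφ, hmin⟩ := extraction_of_frequently_atTop
    (P := fun l => k₀ ≤ l ∧ ∀ m, k₀ ≤ m → m ≤ l → residual p A y (x l) ≤ residual p A y (x m))
    (frequently_atTop.2 (exists_running_min hpos hsmall))
  obtain ⟨v, hv⟩ := hy
  set T : ℕ → ℝ := fun k => ∑ m ∈ Finset.range k, ν m * residual p A y (x m) with hT
  set U : ℕ → ℝ := fun k => bregman p q (x k) v - T k with hU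
  have hUlim : CauchySeq U := by
    have h1 : Tendsto (fun k => bregman p q (x (k + k₀)) v) atTop
        (𝓝 (⨅ k, bregman p q (x (k + k₀)) v)) := by
      refine tendsto_atTop_ciInf (antitone_nat_of_succ_le fun k => ?_)
        ⟨0, by rintro _ ⟨k, rfl⟩; exact bregman_nonneg hpq _ _⟩
      rw [add_right_comm]
      exact hanti v hv _ (by omega)
    exact (((tendsto_add_atTop_iff_nat k₀).1 h1).sub hsum.hasSum.tendsto_sum_nat).cauchySeq
  have hdiff : ∀ k l, k₀ ≤ k → k ≤ l →
      (∀ m, k₀ ≤ m → m ≤ l → residual p A y (x l) ≤ residual p A y (x m)) →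
      (J p (x l) - J p (x k)) (x l - v) ≤ T l - T k := by
    intro k l hk hkl hl
    have htel : J p (x l) - J p (x k) =
        ∑ m ∈ Finset.Ico k l, -(ν m • direction A y j (x m) (s m)) := by
      rw [← Finset.sum_Ico_sub (fun m => J p (x m)) hkl]
      refine Finset.sum_congr rfl fun m _ => ?_
      rw [hJ m]
      abel
    rw [htel, ← Finset.sum_Ico_eq_sub _ hkl, FunLike.coe_sum, Finset.sum_apply]
    refine Finset.sum_le_sum fun m hm => ?_
    obtain ⟨hm1, hm2⟩ := Finset.mem_Ico.1 hm
    have h1 := abs_direction_apply_sub_le hpq hj hv (hl m (hk.trans hm1) hm2.le) (s m)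
    rw [FunLike.coe_neg, Pi.neg_apply, FunLike.coe_smul, Pi.smul_apply, smul_eq_mul, ← mul_neg]
    exact mul_le_mul_of_nonneg_left ((neg_le_abs _).trans h1) (hν0 m).le
  have hcau : CauchySeq (x ∘ φ) := by
    rw [Metric.cauchySeq_iff']
    intro ε hε
    obtain ⟨n₀, hn₀⟩ := Metric.cauchySeq_iff'.1 (hUlim.comp_tendsto hφ.tendsto_atTop) (c * ε ^ p)
      (by positivity)
    refine ⟨n₀, fun n hn => ?_⟩
    have h1 := hdiff (φ n₀) (φ n) (hmin n₀).1 (hφ.monotone hn) (hmin n).2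
    have h2 := (hD (x (φ n₀)) (x (φ n))).trans_eq
      (bregman_three_point hpq (x (φ n₀)) (x (φ n)) v)
    have h3 := hn₀ n hn
    rw [Real.dist_eq, abs_lt] at h3
    have h4 : c * ‖x (φ n₀) - x (φ n)‖ ^ p < c * ε ^ p := by
      have h5 : U (φ n₀) - U (φ n) < c * ε ^ p := by
        have := h3.1
        simp only [Function.comp_apply] at this
        linarith
      simp only [hU] at h5
      linarith
    rw [dist_comm, dist_eq_norm]
    exact (Real.rpow_lt_rpow_iff (norm_nonneg _) hε.le hp0).1 (lt_of_mul_lt_mul_left h4 hc.le)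
  obtain ⟨z, hz⟩ := cauchySeq_tendsto_of_complete hcau
  have hres : Tendsto (fun n => residual p A y (x (φ n))) atTop (𝓝 0) := by
    rw [Metric.tendsto_atTop]
    intro ε hε
    obtain ⟨m, hm, hmε⟩ := hsmall ε hε k₀
    refine ⟨m, fun n hn => ?_⟩
    rw [Real.dist_eq, sub_zero, abs_of_nonneg (residual_nonneg _)]
    exact ((hmin n).2 m hm (hn.trans (hφ.id_le n))).trans_lt hmε
  have hz0 : residual p A y z = 0 :=
    tendsto_nhds_unique (((continuous_residual hp0).tendsto z).comp hz) hres
  have hAz := eq_of_residual_eq_zero hp0 hz0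
  refine ⟨z, hAz, hconc z hAz fun ε hε => ?_⟩
  obtain ⟨n, hn⟩ := ((tendsto_bregman_zero hpq hz).eventually (gt_mem_nhds hε)).exists
  exact ⟨φ n, (hmin n).1, hn⟩

end Trajectory

/-! ### Exponents below two force the dimension to be at most one -/

section LowExponent

variable {X : Type*} [NormedAddCommGroup X] [NormedSpace ℝ X] {p : ℝ}

/-- If two vectors `x, v` were independent, then the convex Lipschitz function
`t ↦ ‖x + t • v‖` would have all its second differences on `[0, 1]` with step `h` bounded below
by a multiple of `h ^ p`. Adding up those on a grid of mesh `h = 1 / n` telescopes to first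
differences and gives `n h ^ p ≲ h`, which fails for large `n` when `p < 2`. -/
theorem IsPConvex.exists_eq_smul (hX : IsPConvex X p) (hp0 : 0 < p) (hp : p < 2) {v : X}
    (hv : v ≠ 0) (x : X) : ∃ t : ℝ, x = t • v := by
  obtain ⟨χ, hχv⟩ := SeparatingDual.exists_eq_one (R := ℝ) hv
  refine ⟨χ x, by_contra fun hne => ?_⟩
  -- Correct `x` and the functionals so that `(χ, ψ)` is dual to `(v, w)`.
  set w := x - χ x • v with hw
  have hw0 : w ≠ 0 := sub_ne_zero.2 hne
  have hχw : χ w = 0 := by simp [hw, hχv]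
  obtain ⟨f, hfw⟩ := SeparatingDual.exists_eq_one (R := ℝ) hw0
  set ψ := f - f v • χ with hψ
  have hψv : ψ v = 0 := by simp [hψ, hχv]
  have hψw : ψ w = 1 := by simp [hψ, hχw, hfw]
  obtain ⟨K, hK, hadd⟩ := hX.exists_norm_add_le hp0
  have hψ0 : 0 < ‖ψ‖ := norm_pos_iff.2 fun h => by simp [h] at hψw
  set M := ‖w‖ + 2 * ‖v‖ with hM
  have hM0 : 0 < M := by
    have := norm_pos_iff.2 hw0
    positivity
  set L := ‖χ‖ + ‖ψ‖ with hL
  have hL0 : 0 < L := by positivity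
  have hval : ∀ t : ℝ, ψ (w + t • v) = 1 ∧ χ (w + t • v) = t := fun t => by
    simp [hψv, hψw, hχv, hχw]
  have hne0 : ∀ t : ℝ, w + t • v ≠ 0 := fun t h => by
    have := (hval t).1
    simp [h] at this
  have hlow : ∀ t : ℝ, ‖ψ‖⁻¹ ≤ ‖w + t • v‖ := fun t => by
    have := ψ.le_opNorm (w + t • v)
    rw [(hval t).1, norm_one] at this
    rwa [inv_le_iff_one_le_mul₀' hψ0]
  have hup : ∀ t : ℝ, |t| ≤ 2 → ‖w + t • v‖ ≤ M := fun t ht => by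
    refine (norm_add_le _ _).trans ?_
    rw [norm_smul, Real.norm_eq_abs]
    exact add_le_add_right (mul_le_mul_of_nonneg_right ht (norm_nonneg v)) _
  have hangle : ∀ t h : ℝ, 0 ≤ t → t ≤ 1 → 0 ≤ h → h ≤ 1 →
      h * (2 / (M * L)) ≤ ‖‖w + (t + h) • v‖⁻¹ • (w + (t + h) • v) -
        ‖w + (t - h) • v‖⁻¹ • (w + (t - h) • v)‖ := by
    intro t h ht0 ht1 hh0 hh1
    set α := ‖w + (t + h) • v‖ with hα
    set β := ‖w + (t - h) • v‖ with hβ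
    set d := α⁻¹ • (w + (t + h) • v) - β⁻¹ • (w + (t - h) • v) with hd
    have hα0 : 0 < α := norm_pos_iff.2 (hne0 _)
    have hβ0 : 0 < β := norm_pos_iff.2 (hne0 _)
    have hαM : α ≤ M := hup _ (abs_le.2 ⟨by linarith, by linarith⟩)
    have hβM : β ≤ M := hup _ (abs_le.2 ⟨by linarith, by linarith⟩)
    have h1 : (χ - t • ψ) d = h * (α⁻¹ + β⁻¹) := by
      rw [hd, map_sub, map_smul, map_smul]
      simp only [FunLike.coe_sub, FunLike.coe_smul, Pi.sub_apply, Pi.smul_apply, hval,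
        smul_eq_mul]
      ring
    have h2 : ‖χ - t • ψ‖ ≤ L := by
      refine (norm_sub_le _ _).trans ?_
      rw [norm_smul, Real.norm_of_nonneg ht0]
      have := mul_le_mul_of_nonneg_right ht1 (norm_nonneg ψ)
      linarith
    have h3 : h * (α⁻¹ + β⁻¹) ≤ L * ‖d‖ := by
      rw [← h1]
      exact (le_abs_self _).trans (((χ - t • ψ).le_opNorm d).trans (by gcongr))
    have h4 : 2 / M ≤ α⁻¹ + β⁻¹ := by
      have h5 := inv_anti₀ hα0 hαM
      have h6 := inv_anti₀ hβ0 hβM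
      rw [div_eq_mul_inv]
      linarith
    have h7 := (mul_le_mul_of_nonneg_left h4 hh0).trans h3
    rw [← div_div, ← mul_div_assoc, div_le_iff₀ hL0]
    linarith
  set c := 2 * K * ‖ψ‖⁻¹ * (2 / (M * L)) ^ p with hc
  have hc0 : 0 < c := by positivity
  have hsecond : ∀ t h : ℝ, 0 ≤ t → t ≤ 1 → 0 ≤ h → h ≤ 1 →
      c * h ^ p ≤ ‖w + (t + h) • v‖ - ‖w + t • v‖ - (‖w + t • v‖ - ‖w + (t - h) • v‖) := by
    intro t h ht0 ht1 hh0 hh1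
    have hang := hangle t h ht0 ht1 hh0 hh1
    have hsum : w + (t + h) • v + (w + (t - h) • v) = (2 : ℝ) • (w + t • v) := by module
    have hsum' : ‖w + (t + h) • v + (w + (t - h) • v)‖ = 2 * ‖w + t • v‖ := by
      rw [hsum, norm_smul, Real.norm_of_nonneg zero_le_two]
    have key : ∀ b : ℝ, ∀ s : ℝ, ‖ψ‖⁻¹ ≤ b → h * (2 / (M * L)) ≤ s →
        c * h ^ p ≤ 2 * K * b * s ^ p := by
      intro b s hb hs
      have hb0 : 0 ≤ b := (inv_pos.2 hψ0).le.trans hb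
      have h1 : (h * (2 / (M * L))) ^ p ≤ s ^ p :=
        Real.rpow_le_rpow (by positivity) hs hp0.le
      rw [Real.mul_rpow hh0 (by positivity)] at h1
      calc c * h ^ p = 2 * K * ‖ψ‖⁻¹ * (h ^ p * (2 / (M * L)) ^ p) := by rw [hc]; ring
        _ ≤ 2 * K * b * s ^ p := by gcongr
    rcases le_total ‖w + (t - h) • v‖ ‖w + (t + h) • v‖ with hle | hle
    · have h1 := hadd _ _ (hne0 _) (hne0 _) hle
      have h2 := key _ _ (hlow (t - h)) hang
      linarith
    · have h1 := hadd _ _ (hne0 _) (hne0 _) hle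
      rw [norm_sub_rev] at hang
      rw [add_comm (w + (t - h) • v)] at h1
      have h2 := key _ _ (hlow (t + h)) hang
      linarith
  have hlip : ∀ t s : ℝ, ‖w + t • v‖ - ‖w + s • v‖ ≤ |t - s| * ‖v‖ := fun t s => by
    refine (norm_sub_norm_le _ _).trans_eq ?_
    rw [add_sub_add_left_eq_sub, ← sub_smul, norm_smul, Real.norm_eq_abs]
  have hgrid : ∀ n : ℕ, c ≤ 2 * ‖v‖ * ((n + 1 : ℕ) : ℝ) ^ (-(2 - p)) := by
    intro n
    set m : ℝ := ((n + 1 : ℕ) : ℝ) with hm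
    have hm1 : 1 ≤ m := by rw [hm]; exact_mod_cast Nat.succ_le_succ (Nat.zero_le n)
    have hm0 : 0 < m := by linarith
    set h := m⁻¹ with hh
    have hh0 : 0 < h := inv_pos.2 hm0
    have hh1 : h ≤ 1 := inv_le_one_of_one_le₀ hm1
    have hmh : m * h = 1 := mul_inv_cancel₀ hm0.ne'
    set g : ℕ → ℝ := fun k => ‖w + (k * h) • v‖ - ‖w + (k * h - h) • v‖ with hg
    have h1 : ∑ k ∈ Finset.range (n + 1), c * h ^ p ≤
        ∑ k ∈ Finset.range (n + 1), (g (k + 1) - g k) := by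
      refine Finset.sum_le_sum fun k hk => ?_
      have hkm : (k : ℝ) ≤ m := by
        rw [hm]
        exact_mod_cast (Finset.mem_range.1 hk).le
      have h2 := hsecond (k * h) h (by positivity)
        ((mul_le_mul_of_nonneg_right hkm hh0.le).trans_eq hmh) hh0.le hh1
      have h3 : ((k + 1 : ℕ) : ℝ) * h = k * h + h := by push_cast; ring
      simp only [hg, h3, add_sub_cancel_right]
      exact h2
    rw [Finset.sum_range_sub, Finset.sum_const, Finset.card_range, nsmul_eq_mul, ← hm] at h1
    have h4 : g (n + 1) ≤ h * ‖v‖ := by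
      refine (hlip _ _).trans_eq ?_
      rw [sub_sub_cancel, abs_of_pos hh0]
    have h5 : -g 0 ≤ h * ‖v‖ := by
      have := hlip (((0 : ℕ) : ℝ) * h - h) (((0 : ℕ) : ℝ) * h)
      rw [sub_sub_cancel_left, abs_neg, abs_of_pos hh0] at this
      simp only [hg]
      linarith
    have h6 : h ^ p = m ^ (-p) := by rw [hh, Real.inv_rpow hm0.le, Real.rpow_neg hm0.le]
    have h7 : m * (c * h ^ p) ≤ 2 * (h * ‖v‖) := by linarith
    have h8 : m * (m * h ^ p) = m ^ (2 - p) := by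
      rw [h6, mul_comm m (m ^ (-p)), ← Real.rpow_add_one hm0.ne', mul_comm,
        ← Real.rpow_add_one hm0.ne']
      congr 1
      ring
    have h9 := mul_le_mul_of_nonneg_left h7 hm0.le
    have h10 : m * (2 * (h * ‖v‖)) = 2 * ‖v‖ := by
      rw [show m * (2 * (h * ‖v‖)) = m * h * (2 * ‖v‖) by ring, hmh, one_mul]
    have h11 : m * (m * (c * h ^ p)) = c * m ^ (2 - p) := by rw [← h8]; ring
    rw [h10, h11] at h9
    rw [Real.rpow_neg hm0.le, ← div_eq_mul_inv, le_div_iff₀ (by positivity)]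
    exact h9
  have hlim : Tendsto (fun n : ℕ => 2 * ‖v‖ * ((n + 1 : ℕ) : ℝ) ^ (-(2 - p))) atTop (𝓝 0) := by
    have h1 := ((tendsto_rpow_neg_atTop (sub_pos.2 hp)).comp
      (tendsto_natCast_atTop_atTop (R := ℝ))).comp (tendsto_add_atTop_nat 1)
    simpa using h1.const_mul (2 * ‖v‖)
  exact absurd (ge_of_tendsto' hlim hgrid) (not_le.2 hc0)

end LowExponent

/-! ### Convergence of a single trajectory in dimension one -/

section SignedPower

/-- The odd extension `t ↦ sign t * |t| ^ s` of the power function; for `s = p - 1` it is the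
duality map `J_p` of the real line. -/
noncomputable def signedPower (s t : ℝ) : ℝ := Real.sign t * |t| ^ s

variable {s : ℝ}

theorem signedPower_of_nonneg (hs : 0 < s) {t : ℝ} (ht : 0 ≤ t) : signedPower s t = t ^ s := by
  rcases ht.eq_or_lt with rfl | ht
  · simp [signedPower, Real.zero_rpow hs.ne']
  · rw [signedPower, Real.sign_of_pos ht, abs_of_pos ht, one_mul]

theorem signedPower_neg (t : ℝ) : signedPower s (-t) = -signedPower s t := by
  rw [signedPower, signedPower, Real.sign_neg, abs_neg, neg_mul]

theorem abs_signedPower (hs : 0 < s) (t : ℝ) : |signedPower s t| = |t| ^ s := by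
  rcases le_total 0 t with ht | ht
  · rw [signedPower_of_nonneg hs ht, abs_of_nonneg ht, abs_of_nonneg (by positivity)]
  · rw [← abs_neg, ← signedPower_neg, signedPower_of_nonneg hs (neg_nonneg.2 ht), ← abs_neg t,
      abs_of_nonneg (neg_nonneg.2 ht), abs_of_nonneg (Real.rpow_nonneg (neg_nonneg.2 ht) s)]

theorem strictMono_signedPower (hs : 0 < s) : StrictMono (signedPower s) := by
  refine strictMono_of_odd_strictMonoOn_nonneg signedPower_neg fun a ha b hb hab => ?_
  rw [signedPower_of_nonneg hs ha, signedPower_of_nonneg hs hb]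
  exact Real.rpow_lt_rpow ha hab hs

theorem signedPower_zero : signedPower s 0 = 0 := by simp [signedPower]

theorem signedPower_sub_mul_nonneg (hs : 0 < s) (t u : ℝ) :
    0 ≤ (signedPower s t - signedPower s u) * signedPower s (t - u) := by
  have hmono := (strictMono_signedPower hs).monotone
  rcases le_total u t with h | h
  · refine mul_nonneg (sub_nonneg.2 (hmono h)) ?_
    rw [signedPower_of_nonneg hs (sub_nonneg.2 h)]
    exact Real.rpow_nonneg (sub_nonneg.2 h) s
  · refine mul_nonneg_of_nonpos_of_nonpos (sub_nonpos.2 (hmono h)) ?_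
    rw [← signedPower_zero (s := s)]
    exact hmono (sub_nonpos.2 h)

theorem abs_signedPower_sub_le (hs : 0 < s) (hs1 : s ≤ 1) (t u : ℝ) :
    |signedPower s (t - u)| ≤ |signedPower s t| + |signedPower s u| := by
  simp only [abs_signedPower hs]
  exact (Real.rpow_le_rpow (abs_nonneg _) (abs_sub t u) hs.le).trans
    (Real.rpow_add_le_add_rpow (abs_nonneg t) (abs_nonneg u) hs.le hs1)

/-- The signed power with exponent at most one is Hölder continuous. -/
theorem abs_signedPower_sub_signedPower_le (hs : 0 < s) (hs1 : s ≤ 1) (t u : ℝ) :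
    |signedPower s t - signedPower s u| ≤ 2 * |signedPower s (t - u)| := by
  have hsame : ∀ a b : ℝ, 0 ≤ a → a ≤ b → |b ^ s - a ^ s| ≤ 2 * |b - a| ^ s := by
    intro a b ha hab
    have h1 := Real.rpow_add_le_add_rpow ha (sub_nonneg.2 hab) hs.le hs1
    rw [add_sub_cancel] at h1
    have h2 := Real.rpow_le_rpow ha hab hs.le
    have h3 := Real.rpow_nonneg (sub_nonneg.2 hab) s
    rw [abs_of_nonneg (sub_nonneg.2 h2), abs_of_nonneg (sub_nonneg.2 hab)]
    linarith
  have hpos : ∀ a b : ℝ, 0 ≤ a → 0 ≤ b → |b ^ s - a ^ s| ≤ 2 * |b - a| ^ s := by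
    intro a b ha hb
    rcases le_total a b with h | h
    · exact hsame a b ha h
    · rw [abs_sub_comm, abs_sub_comm b]
      exact hsame b a hb h
  have hopp : ∀ a b : ℝ, 0 ≤ a → 0 ≤ b → |b ^ s + a ^ s| ≤ 2 * |b + a| ^ s := by
    intro a b ha hb
    have h1 := Real.rpow_le_rpow ha (le_add_of_nonneg_left hb) hs.le
    have h2 := Real.rpow_le_rpow hb (le_add_of_nonneg_right ha) hs.le
    rw [abs_of_nonneg (by positivity), abs_of_nonneg (by positivity)]
    linarith
  rw [abs_signedPower hs]
  have hneg : ∀ a : ℝ, a ≤ 0 → signedPower s a = -(-a) ^ s := fun a ha => by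
    rw [← signedPower_of_nonneg hs (neg_nonneg.2 ha), signedPower_neg, neg_neg]
  rcases le_total 0 t with ht | ht <;> rcases le_total 0 u with hu | hu
  · rw [signedPower_of_nonneg hs ht, signedPower_of_nonneg hs hu]
    exact hpos u t hu ht
  · rw [signedPower_of_nonneg hs ht, hneg u hu, sub_neg_eq_add, sub_eq_add_neg t]
    exact hopp (-u) t (neg_nonneg.2 hu) ht
  · rw [signedPower_of_nonneg hs hu, hneg t ht, ← abs_neg, ← abs_neg (t - u)]
    have := hopp u (-t) hu (neg_nonneg.2 ht)
    convert this using 2 <;> ring_nf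
  · rw [hneg t ht, hneg u hu]
    have := hpos (-t) (-u) (neg_nonneg.2 ht) (neg_nonneg.2 hu)
    convert this using 2 <;> ring_nf

/-- Errors `e` which are corrected by steps `l k * F k` in the right direction tend to zero if
the step sizes tend to zero and have a divergent sum. Overshooting is possible, but it leaves an
error of at most `l k * B`. -/
theorem tendsto_zero_of_correction {e F l : ℕ → ℝ} {B : ℝ}
    (hstep : ∀ k, e (k + 1) = e k - l k * F k) (hl0 : ∀ k, 0 ≤ l k)
    (hl : Tendsto l atTop (𝓝 0)) (hns : ¬ Summable l) (hsign : ∀ k, 0 ≤ e k * F k)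
    (hle : ∀ k, |e k| ≤ 2 * |F k|) (hFB : ∀ k, |F k| ≤ |e k| + B) :
    Tendsto e atTop (𝓝 0) := by
  have habs : ∀ k, |e (k + 1)| = |e k| - l k * |F k| ∨
      |e (k + 1)| = l k * |F k| - |e k| := by
    intro k
    rw [hstep]
    have h1 : ∀ a b : ℝ, 0 ≤ a * b → |a - b| = |(|a| - |b|)| := by
      intro a b hab
      rcases mul_nonneg_iff.1 hab with ⟨ha, hb⟩ | ⟨ha, hb⟩
      · rw [abs_of_nonneg ha, abs_of_nonneg hb]
      · rw [abs_of_nonpos ha, abs_of_nonpos hb, ← abs_neg]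
        congr 1
        ring
    have h2 := h1 (e k) (l k * F k) (by
      have := mul_nonneg (hl0 k) (hsign k)
      linarith)
    rw [abs_mul, abs_of_nonneg (hl0 k)] at h2
    rw [h2]
    rcases abs_choice (|e k| - l k * |F k|) with h | h
    · exact Or.inl h
    · right
      rw [h]
      ring
  rw [Metric.tendsto_atTop]
  intro ε' hε'
  obtain ⟨ε, hε, hεε'⟩ := exists_between hε'
  have hlB : Tendsto (fun k => l k * B) atTop (𝓝 0) := by simpa using hl.mul_const B
  obtain ⟨k₀, hk₀⟩ := eventually_atTop.1
    ((hl.eventually (gt_mem_nhds one_pos)).and (hlB.eventually (gt_mem_nhds hε)))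
  have hover : ∀ k ≥ k₀, |e (k + 1)| = l k * |F k| - |e k| → |e (k + 1)| ≤ ε := by
    intro k hk h
    have h1 := mul_le_mul_of_nonneg_left (hFB k) (hl0 k)
    have h2 := mul_le_mul_of_nonneg_right (hk₀ k hk).1.le (abs_nonneg (e k))
    have h3 := (hk₀ k hk).2
    linarith
  have hex : ∃ k ≥ k₀, |e k| ≤ ε := by
    by_contra! hbig
    have hdec : ∀ k ≥ k₀, |e (k + 1)| + l k * (ε / 2) ≤ |e k| := by
      intro k hk
      rcases habs k with h | h
      · have h1 : ε / 2 ≤ |F k| := by linarith [hle k, hbig k hk]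
        have h2 := mul_le_mul_of_nonneg_left h1 (hl0 k)
        linarith
      · exact absurd (hover k hk h) (not_le.2 (hbig (k + 1) (by omega)))
    have hsum : ∀ n, ∑ k ∈ Finset.range n, l (k + k₀) * (ε / 2) ≤ |e k₀| - |e (n + k₀)| := by
      intro n
      induction n with
      | zero => simp
      | succ n ih =>
        rw [Finset.sum_range_succ, add_right_comm]
        linarith [hdec (n + k₀) (by omega)]
    have h1 : Summable fun k => l (k + k₀) * (ε / 2) :=
      summable_of_sum_range_le (fun k => mul_nonneg (hl0 _) (by positivity))
        fun n => (hsum n).trans (sub_le_self _ (abs_nonneg _))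
    have h2 := h1.mul_right (ε / 2)⁻¹
    simp only [mul_assoc, mul_inv_cancel₀ (half_pos hε).ne', mul_one] at h2
    exact hns ((summable_nat_add_iff k₀).1 h2)
  obtain ⟨k₁, hk₁, he⟩ := hex
  refine ⟨k₁, fun k hk => ?_⟩
  rw [Real.dist_eq, sub_zero]
  refine lt_of_le_of_lt ?_ hεε'
  induction k, hk using Nat.le_induction with
  | base => exact he
  | succ k hk ih =>
    rcases habs k with h | h
    · have := mul_nonneg (hl0 k) (abs_nonneg (F k))
      linarith
    · exact hover k (hk₁.trans hk) h

theorem tendsto_of_tendsto_signedPower (hs : 0 < s) {t : ℕ → ℝ} {u : ℝ}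
    (h : Tendsto (fun k => signedPower s (t k)) atTop (𝓝 (signedPower s u))) :
    Tendsto t atTop (𝓝 u) := by
  have hmono := strictMono_signedPower hs
  refine tendsto_order.2 ⟨fun a ha => ?_, fun a ha => ?_⟩
  · exact (h.eventually (lt_mem_nhds (hmono ha))).mono fun k hk => hmono.lt_iff_lt.1 hk
  · exact (h.eventually (gt_mem_nhds (hmono ha))).mono fun k hk => hmono.lt_iff_lt.1 hk

theorem eq_signedPower_of_mul_eq {p t θ b : ℝ} (hp : 1 < p) (h : t * θ = |t| ^ p * b)
    (h0 : t = 0 → θ = 0) : θ = b * signedPower (p - 1) t := by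
  rcases eq_or_ne t 0 with rfl | ht
  · rw [h0 rfl, signedPower_zero, mul_zero]
  · have h1 : |t| ^ p = |t| * |t| ^ (p - 1) := by
      rw [← Real.rpow_one_add' (abs_nonneg t) (by linarith)]
      congr 1
      ring
    have h2 : |t| = t * Real.sign t := by
      rcases ht.lt_or_gt with h | h
      · rw [abs_of_neg h, Real.sign_of_neg h]
        ring
      · rw [abs_of_pos h, Real.sign_of_pos h, mul_one]
    refine mul_left_cancel₀ ht ?_
    rw [h, h1, signedPower]
    nth_rewrite 1 [h2]
    ring

end SignedPower

section OneDimensional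

variable {X : Type*} [NormedAddCommGroup X] [NormedSpace ℝ X]
  {N : ℕ} {Y : Fin N → Type*} [∀ i, NormedAddCommGroup (Y i)] [∀ i, NormedSpace ℝ (Y i)]
  {r : ℝ≥0∞} {p : ℝ}
  {A : X →L[ℝ] PiLp r Y} {y : PiLp r Y} {j : ∀ i, Y i → StrongDual ℝ (Y i)}

theorem J_smul_apply (hp : 1 < p) {e : X} (he : ‖e‖ = 1) (t : ℝ) :
    J p (t • e) e = signedPower (p - 1) t := by
  have h1 := J_apply_self hp (t • e)
  rw [map_smul, smul_eq_mul, norm_smul, he, mul_one, Real.norm_eq_abs] at h1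
  rw [← one_mul (signedPower _ _)]
  refine eq_signedPower_of_mul_eq hp (by rw [h1, mul_one]) fun ht => ?_
  have h2 := norm_J hp (t • e)
  rw [ht, zero_smul, norm_zero, Real.zero_rpow (sub_pos.2 hp).ne', norm_eq_zero] at h2
  rw [ht, zero_smul, h2]
  rfl

theorem direction_smul_apply (hp : 1 < p) (hj : ∀ i (v : Y i), j i v ∈ dualityMap p v) {e : X}
    {u : ℝ} (hu : A (u • e) = y) (t : ℝ) (i : Fin N) :
    direction A y j (t • e) i e =
      ‖component A i e‖ ^ p * signedPower (p - 1) (t - u) := by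
  have hR : component A i (t • e) - y i = (t - u) • component A i e := by
    rw [← component_apply_eq hu, ← map_sub, ← sub_smul, map_smul]
  refine eq_signedPower_of_mul_eq hp ?_ fun ht => ?_
  · have h1 := direction_apply_self hj hp hu (t • e) i
    rw [← sub_smul, map_smul, smul_eq_mul, hR, norm_smul, Real.norm_eq_abs,
      Real.mul_rpow (abs_nonneg _) (norm_nonneg _)] at h1
    exact h1
  · have h2 := norm_direction_le (A := A) (y := y) hj (t • e) i
    rw [hR, ht, zero_smul, norm_zero, Real.zero_rpow (sub_pos.2 hp).ne', zero_mul,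
      norm_le_zero_iff] at h2
    rw [h2]
    rfl

/-- On a line the iteration, in the coordinate `ξ = J_p x`, moves towards the solution with the
effective step sizes `ν k * ‖A_i e‖ ^ p`; for `p ≤ 2` the Hölder continuity of `J_p` makes it
converge whenever these have a divergent sum. -/
theorem tendsto_of_one_dimensional (hp : 1 < p) (hp2 : p ≤ 2)
    (hj : ∀ i (v : Y i), j i v ∈ dualityMap p v) {e : X} (he : ‖e‖ = 1)
    (hspan : ∀ x : X, ∃ t : ℝ, x = t • e) {ν : ℕ → ℝ} (hν0 : ∀ k, 0 ≤ ν k)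
    (hν : Tendsto ν atTop (𝓝 0)) {x : ℕ → X} {s : ℕ → Fin N}
    (hJ : ∀ k, J p (x (k + 1)) = J p (x k) - ν k • direction A y j (x k) (s k))
    (hns : ¬ Summable fun k => ν k * ‖component A (s k) e‖ ^ p) {z : X} (hz : A z = y) :
    Tendsto x atTop (𝓝 z) := by
  have hs : 0 < p - 1 := sub_pos.2 hp
  have hs1 : p - 1 ≤ 1 := by linarith
  choose t ht using fun k => hspan (x k)
  obtain ⟨u, rfl⟩ := hspan z
  set l : ℕ → ℝ := fun k => ν k * ‖component A (s k) e‖ ^ p with hl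
  have hl0 : ∀ k, 0 ≤ l k := fun k => mul_nonneg (hν0 k) (by positivity)
  have hllim : Tendsto l atTop (𝓝 0) := by
    set L := ∑ i, ‖component A i e‖ ^ p with hL
    refine squeeze_zero hl0 (fun k => mul_le_mul_of_nonneg_left ?_ (hν0 k))
      (by simpa using hν.mul_const L)
    exact Finset.single_le_sum (f := fun i => ‖component A i e‖ ^ p)
      (fun _ _ => by positivity) (Finset.mem_univ _)
  have hstep : ∀ k, signedPower (p - 1) (t (k + 1)) - signedPower (p - 1) u =
      signedPower (p - 1) (t k) - signedPower (p - 1) u -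
        l k * signedPower (p - 1) (t k - u) := by
    intro k
    have h1 := congrArg (fun ξ : StrongDual ℝ X => ξ e) (hJ k)
    simp only [FunLike.coe_sub, FunLike.coe_smul, Pi.sub_apply, Pi.smul_apply, smul_eq_mul] at h1
    rw [ht k, ht (k + 1), J_smul_apply hp he, J_smul_apply hp he,
      direction_smul_apply hp hj hz] at h1
    rw [h1, hl]
    ring
  have hlim := tendsto_zero_of_correction (e := fun k =>
      signedPower (p - 1) (t k) - signedPower (p - 1) u)
    (F := fun k => signedPower (p - 1) (t k - u)) (B := 2 * |signedPower (p - 1) u|)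
    hstep hl0 hllim hns (fun k => signedPower_sub_mul_nonneg hs _ _)
    (fun k => abs_signedPower_sub_signedPower_le hs hs1 _ _) (fun k => by
      have h1 := abs_signedPower_sub_le hs hs1 (t k) u
      have h2 := abs_sub_abs_le_abs_sub (signedPower (p - 1) (t k)) (signedPower (p - 1) u)
      linarith)
  have htu : Tendsto t atTop (𝓝 u) :=
    tendsto_of_tendsto_signedPower hs (by simpa using hlim.add_const (signedPower (p - 1) u))
  have := htu.smul_const e
  exact this.congr fun k => (ht k).symm

theorem J_injective_of_one_dimensional (hp : 1 < p) {e : X} (he : ‖e‖ = 1)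
    (hspan : ∀ x : X, ∃ t : ℝ, x = t • e) : Function.Injective (J p : X → StrongDual ℝ X) := by
  intro x x' h
  obtain ⟨t, rfl⟩ := hspan x
  obtain ⟨t', rfl⟩ := hspan x'
  have h1 := congrArg (fun ξ : StrongDual ℝ X => ξ e) h
  simp only [J_smul_apply hp he] at h1
  rw [(strictMono_signedPower (sub_pos.2 hp)).injective h1]

end OneDimensional

/-! ### Almost sure convergence -/

section AlmostSure

variable {X : Type*} [NormedAddCommGroup X] [NormedSpace ℝ X]
  {N : ℕ} {Y : Fin N → Type*} [∀ i, NormedAddCommGroup (Y i)] [∀ i, NormedSpace ℝ (Y i)]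
  {r : ℝ≥0∞} {p q : ℝ}
  {A : X →L[ℝ] PiLp r Y} {y : PiLp r Y} {j : ∀ i, Y i → StrongDual ℝ (Y i)}

theorem iterate_congr {μ : ℕ → ℝ} {x₀ : X} {s s' : ℕ → Fin N} {k : ℕ}
    (h : ∀ m < k, s (m + 1) = s' (m + 1)) :
    iterate p q A y j μ x₀ s k = iterate p q A y j μ x₀ s' k := by
  induction k with
  | zero => rfl
  | succ k ih =>
    rw [iterate, iterate, ih fun m hm => h m (hm.trans k.lt_succ_self), h k k.lt_succ_self]

theorem J_iterate_succ [CompleteSpace X] (hX : IsPConvex X p) (hs : IsSmooth X)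
    (hpq : p.HolderConjugate q) (μ : ℕ → ℝ) (x₀ : X) (s : ℕ → Fin N) (k : ℕ) :
    J p (iterate p q A y j μ x₀ s (k + 1)) = J p (iterate p q A y j μ x₀ s k)
      - μ (k + 1) • direction A y j (iterate p q A y j μ x₀ s k) (s (k + 1)) := by
  rw [iterate, J_Jstar hX hs hpq]

variable {Ω : Type*} [MeasurableSpace Ω] {P : Measure Ω} {ζ : ℕ → Ω → Fin N} {a : ℝ≥0∞}
  {ν : ℕ → ℝ} {x : ℕ → Ω → X}

theorem ae_exists_tendsto_of_two_le [CompleteSpace X] (hpq : p.HolderConjugate q) (hp : 2 ≤ p)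
    (hX : IsPConvex X p) (hy : y ∈ Set.range A) (hj : ∀ i (v : Y i), j i v ∈ dualityMap p v)
    (hν0 : ∀ k, 0 < ν k) (hνs : ¬ Summable ν) (hνq : Summable fun k => ν k ^ q)
    (hζ : ∀ k, Measurable (ζ k)) (hind : iIndepFun ζ P) (ha : a ≠ 0)
    (hunif : ∀ k n, P {ω | ζ k ω = n} = a)
    (hx : ∀ k ω ω', (∀ m < k, ζ m ω = ζ m ω') → x k ω = x k ω')
    (hJ : ∀ k ω, J p (x (k + 1) ω) = J p (x k ω) - ν k • direction A y j (x k ω) (ζ k ω)) :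
    ∀ᵐ ω ∂P, ∃ z, A z = y ∧ Tendsto (fun k => x k ω) atTop (𝓝 z) := by
  obtain ⟨c, hc, hD⟩ := hX.exists_bregman_ge hpq hp
  obtain ⟨k₀, hk₀⟩ := exists_bregman_decrease (A := A) (y := y) hpq hj hc hD hν0 hνq
  obtain ⟨v, hv⟩ := hy
  have hsum : ∀ n, ∀ᵐ ω ∂P,
      Summable fun k => ν k * (‖component A n (x k ω) - y n‖ ^ p / 2) := fun n =>
    ae_summable_of_lyapunov hζ hind ha (fun k => hunif k n)
      (V := fun k ω => bregman p q (x k ω) v)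
      (fun k ω => mul_nonneg (hν0 k).le (by positivity)) (fun k ω => bregman_nonneg hpq _ _)
      (fun k ω ω' h => by simp only [hx k ω ω' h])
      (fun k ω ω' h => by simp only [hx k ω ω' h]) (k₀ := k₀) (fun k hk ω => by
        have h1 := hk₀ k hk (x k ω) (x (k + 1) ω) v (ζ k ω) hv (hJ k ω)
        split_ifs with hn
        · rwa [hn] at h1
        · have : 0 ≤ ν k * (‖component A (ζ k ω) (x k ω) - y (ζ k ω)‖ ^ p / 2) :=
            mul_nonneg (hν0 k).le (by positivity)
          linarith)
  filter_upwards [ae_all_iff.2 hsum] with ω hω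
  refine exists_tendsto_of_summable_residual (s := fun k => ζ k ω) (k₀ := k₀) hpq hj hc hD hν0
    hνs (fun k => hJ k ω) (fun z hz k hk => ?_) ?_ ⟨v, hv⟩
  · have h1 := hk₀ k hk (x k ω) (x (k + 1) ω) z (ζ k ω) hz (hJ k ω)
    have : 0 ≤ ν k * (‖component A (ζ k ω) (x k ω) - y (ζ k ω)‖ ^ p / 2) :=
      mul_nonneg (hν0 k).le (by positivity)
    linarith
  · have h2 := (summable_sum fun n (_ : n ∈ Finset.univ) => hω n).mul_left 2
    refine h2.congr fun k => ?_
    rw [residual, ← Finset.mul_sum, ← Finset.sum_div]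
    ring

theorem ae_exists_tendsto_of_lt_two (hpq : p.HolderConjugate q) (hp : p < 2)
    (hX : IsPConvex X p) (hy : y ∈ Set.range A) (hj : ∀ i (v : Y i), j i v ∈ dualityMap p v)
    (hν0 : ∀ k, 0 < ν k) (hνs : ¬ Summable ν) (hνq : Summable fun k => ν k ^ q)
    (hζ : ∀ k, Measurable (ζ k)) (hind : iIndepFun ζ P) (ha : a ≠ 0)
    (hunif : ∀ k n, P {ω | ζ k ω = n} = a)
    (hJ : ∀ k ω, J p (x (k + 1) ω) = J p (x k ω) - ν k • direction A y j (x k ω) (ζ k ω)) :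
    ∀ᵐ ω ∂P, ∃ z, A z = y ∧ Tendsto (fun k => x k ω) atTop (𝓝 z) := by
  obtain ⟨v, hv⟩ := hy
  have hνlim := tendsto_zero_of_summable_rpow hpq.symm.pos (fun k => (hν0 k).le) hνq
  rcases subsingleton_or_nontrivial X with hsub | hnt
  · exact Eventually.of_forall fun ω => ⟨v, hv, tendsto_const_nhds.congr fun k =>
      Subsingleton.elim _ _⟩
  obtain ⟨e, he⟩ := exists_norm_eq X zero_le_one
  have hspan : ∀ x : X, ∃ t : ℝ, x = t • e := hX.exists_eq_smul hpq.pos hp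
    (norm_ne_zero_iff.1 (by rw [he]; exact one_ne_zero))
  by_cases hA : ∃ n, component A n e ≠ 0
  · obtain ⟨n, hn⟩ := hA
    have hpos : 0 < ‖component A n e‖ ^ p := Real.rpow_pos_of_pos (norm_pos_iff.2 hn) p
    obtain ⟨b, hb⟩ := hνlim.bddAbove_range
    classical
    filter_upwards [ae_not_summable_ite hζ hind ha (fun k => hunif k n)
      (fun k => (hν0 k).le) (fun k => hb ⟨k, rfl⟩) hνs] with ω hω
    refine ⟨v, hv, tendsto_of_one_dimensional (s := fun k => ζ k ω) hpq.lt hp.le hj he hspan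
      (fun k => (hν0 k).le) hνlim (fun k => hJ k ω) (fun hsum => hω ?_) hv⟩
    refine (hsum.mul_right (‖component A n e‖ ^ p)⁻¹).of_nonneg_of_le
      (fun k => by split_ifs <;> simp [(hν0 k).le]) fun k => ?_
    split_ifs with hk
    · rw [hk, mul_inv_cancel_right₀ hpos.ne']
    · have := (hν0 k).le
      positivity
  · -- Here `A = 0`, and the iterates are constant.
    push Not at hA
    have hA0 : ∀ n w, component A n w = 0 := fun n w => by
      obtain ⟨t, rfl⟩ := hspan w
      rw [map_smul, hA n, smul_zero]
    refine Eventually.of_forall fun ω => ⟨x 0 ω, ?_, ?_⟩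
    · rw [← hv]
      ext n
      exact (hA0 n (x 0 ω)).trans (hA0 n v).symm
    · have hconst : ∀ k, x k ω = x 0 ω := by
        intro k
        induction k with
        | zero => rfl
        | succ k ih =>
          rw [← ih]
          refine J_injective_of_one_dimensional hpq.lt he hspan ?_
          have : direction A y j (x k ω) (ζ k ω) = 0 := by
            ext w
            simp [direction, adjointMap, hA0]
          rw [hJ k ω, this, smul_zero, sub_zero]
      exact tendsto_const_nhds.congr fun k => (hconst k).symm

end AlmostSure

/-! ### Identification of the limit -/

section MinNorm

variable {X : Type*} [NormedAddCommGroup X] [NormedSpace ℝ X] {p : ℝ}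

theorem apply_eq_zero_of_mem_closure_range_adjointMap {Z : Type*} [NormedAddCommGroup Z]
    [NormedSpace ℝ Z] {A : X →L[ℝ] Z} {ξ : StrongDual ℝ X}
    (hξ : ξ ∈ closure (Set.range (adjointMap A))) {w : X} (hw : A w = 0) : ξ w = 0 := by
  have hcl : IsClosed {η : StrongDual ℝ X | η w = 0} :=
    isClosed_eq (by fun_prop) continuous_const
  refine closure_minimal ?_ hcl hξ
  rintro _ ⟨φ, rfl⟩
  change φ (A w) = 0
  rw [hw, map_zero]

/-- If the functionals `J_p (x k)` annihilate `z - w` and `x k → z`, then `‖z‖ ≤ ‖w‖`: pass to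
the limit in `J_p (x k) z = J_p (x k) w ≤ ‖x k‖ ^ (p - 1) * ‖w‖`. -/
theorem norm_le_of_tendsto (hp : 1 < p) {x : ℕ → X} {z w : X} (hx : Tendsto x atTop (𝓝 z))
    (h : ∀ k, J p (x k) (z - w) = 0) : ‖z‖ ≤ ‖w‖ := by
  have hpow : ∀ s : ℝ, 0 ≤ s → Tendsto (fun k => ‖x k‖ ^ s) atTop (𝓝 (‖z‖ ^ s)) :=
    fun s hs => hx.norm.rpow_const (Or.inr hs)
  have hdist : Tendsto (fun k => ‖x k - z‖) atTop (𝓝 0) := by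
    simpa using (hx.sub_const z).norm
  have hle : ∀ k, ‖x k‖ ^ p - ‖x k‖ ^ (p - 1) * ‖x k - z‖ ≤ ‖x k‖ ^ (p - 1) * ‖w‖ := by
    intro k
    have h1 : J p (x k) z = J p (x k) w := by simpa [sub_eq_zero] using h k
    have h2 : J p (x k) w ≤ ‖x k‖ ^ (p - 1) * ‖w‖ := by
      rw [← norm_J hp]
      exact (le_abs_self _).trans ((J p (x k)).le_opNorm w)
    have h3 : J p (x k) (x k - z) ≤ ‖x k‖ ^ (p - 1) * ‖x k - z‖ := by
      rw [← norm_J hp]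
      exact (le_abs_self _).trans ((J p (x k)).le_opNorm _)
    rw [map_sub, J_apply_self hp] at h3
    linarith
  have hlim := le_of_tendsto_of_tendsto'
    ((hpow p (by linarith)).sub ((hpow (p - 1) (by linarith)).mul hdist))
    ((hpow (p - 1) (by linarith)).mul_const ‖w‖) hle
  rw [mul_zero, sub_zero] at hlim
  rcases eq_or_ne z 0 with rfl | hz
  · simp
  have hz0 : 0 < ‖z‖ := norm_pos_iff.2 hz
  have hsplit : ‖z‖ ^ p = ‖z‖ ^ (p - 1) * ‖z‖ := by
    rw [← Real.rpow_add_one hz0.ne', sub_add_cancel]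
  rw [hsplit] at hlim
  exact le_of_mul_le_mul_left hlim (Real.rpow_pos_of_pos hz0 _)

end MinNorm

end BanachSGD

theorem theorem3p6
    {X : Type*} [NormedAddCommGroup X] [NormedSpace ℝ X] [CompleteSpace X]
    {N : ℕ} {Y : Fin N → Type*} [∀ i, NormedAddCommGroup (Y i)] [∀ i, NormedSpace ℝ (Y i)]
    [∀ i, CompleteSpace (Y i)]
    {r : ℝ≥0∞} [Fact (1 ≤ r)]
    {Ω : Type*} [MeasurableSpace Ω] (P : Measure Ω) [IsProbabilityMeasure P]
    -- `q` is the conjugate exponent of `p`; in particular `1 < p`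
    (p q : ℝ) (hpq : p.HolderConjugate q)
    (hconv : BanachSGD.IsPConvex X p) (hsmooth : BanachSGD.IsSmooth X)
    -- the linear equation with exact data
    (A : X →L[ℝ] PiLp r Y) (y : PiLp r Y) (hy : y ∈ Set.range A)
    -- single-valued selections of the duality maps of the data spaces
    (j : ∀ i, Y i → StrongDual ℝ (Y i))
    (hj : ∀ i (v : Y i), j i v ∈ BanachSGD.dualityMap p v)
    -- step sizes `μ 1, μ 2, …`
    (μ : ℕ → ℝ) (hμ_pos : ∀ k, 0 < μ (k + 1))
    (hμ_sum : Tendsto (fun n => ∑ k ∈ Finset.range n, μ (k + 1)) atTop atTop)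
    (hμ_pow : Summable fun k => μ (k + 1) ^ q)
    -- independent, uniformly distributed random indices `i 1, i 2, …`
    (i : ℕ → Ω → Fin N) (hi_meas : ∀ k, Measurable (i (k + 1)))
    (hi_indep : iIndepFun (fun k => i (k + 1)) P)
    (hi_unif : ∀ k (n : Fin N), P {ω | i (k + 1) ω = n} = (N : ℝ≥0∞)⁻¹)
    (x₀ : X) (x : ℕ → Ω → X)
    (hx : ∀ k ω, x k ω = BanachSGD.iterate p q A y j μ x₀ (fun m => i m ω) k) :
    -- almost surely the iterates converge in norm to some solution
    (∀ᵐ ω ∂P, ∃ z : X, A z = y ∧ Tendsto (fun k => x k ω) atTop (𝓝 z)) ∧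
    (∀ᵐ ω ∂P, Tendsto (fun k => ⨅ z : {z : X // A z = y}, ‖x k ω - z‖) atTop (𝓝 0)) ∧
    -- the minimum norm solution, and convergence to it
    (∃! xdag : X, BanachSGD.IsMinNormSolution A y xdag) ∧
    ∀ xdag : X, BanachSGD.IsMinNormSolution A y xdag →
      BanachSGD.J p x₀ ∈ closure (Set.range (BanachSGD.adjointMap A)) →
      ∀ᵐ ω ∂P, Tendsto (fun k => BanachSGD.bregman p q (x k ω) xdag) atTop (𝓝 0) := by
  have hN : (N : ℝ≥0∞)⁻¹ ≠ 0 := ENNReal.inv_ne_zero.2 (ENNReal.natCast_ne_top N)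
  have hμ_ns : ¬ Summable fun k => μ (k + 1) :=
    (not_summable_iff_tendsto_nat_atTop_of_nonneg fun k => (hμ_pos k).le).2 hμ_sum
  have hJ : ∀ k ω, BanachSGD.J p (x (k + 1) ω) =
      BanachSGD.J p (x k ω) - μ (k + 1) • BanachSGD.direction A y j (x k ω) (i (k + 1) ω) := by
    intro k ω
    rw [hx, hx, BanachSGD.J_iterate_succ hconv hsmooth hpq]
  have hdet : ∀ k ω ω', (∀ m < k, i (m + 1) ω = i (m + 1) ω') → x k ω = x k ω' := by
    intro k ω ω' h
    rw [hx, hx]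
    exact BanachSGD.iterate_congr h
  have hmain : ∀ᵐ ω ∂P, ∃ z : X, A z = y ∧ Tendsto (fun k => x k ω) atTop (𝓝 z) := by
    rcases le_or_gt 2 p with hp | hp
    · exact BanachSGD.ae_exists_tendsto_of_two_le hpq hp hconv hy hj hμ_pos hμ_ns hμ_pow hi_meas
        hi_indep hN hi_unif hdet hJ
    · exact BanachSGD.ae_exists_tendsto_of_lt_two hpq hp hconv hy hj hμ_pos hμ_ns hμ_pow hi_meas
        hi_indep hN hi_unif hJ
  have huniq := BanachSGD.existsUnique_isMinNormSolution hconv A hy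
  refine ⟨hmain, ?_, huniq, fun xdag hxdag hx₀ => ?_⟩
  · filter_upwards [hmain] with ω hω
    obtain ⟨z, hz, hlim⟩ := hω
    have hdist : Tendsto (fun k => ‖x k ω - z‖) atTop (𝓝 0) := by
      simpa using (hlim.sub_const z).norm
    refine squeeze_zero (fun k => Real.iInf_nonneg fun _ => norm_nonneg _) (fun k => ?_) hdist
    exact ciInf_le (f := fun z : {z : X // A z = y} => ‖x k ω - z‖)
      ⟨0, by rintro _ ⟨w, rfl⟩; exact norm_nonneg _⟩ ⟨z, hz⟩
  · have hker : ∀ w, A w = 0 → ∀ k ω, BanachSGD.J p (x k ω) w = 0 := by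
      intro w hw k ω
      induction k with
      | zero =>
        rw [hx]
        exact BanachSGD.apply_eq_zero_of_mem_closure_range_adjointMap hx₀ hw
      | succ k ih =>
        have hdir : BanachSGD.direction A y j (x k ω) (i (k + 1) ω) w = 0 := by
          rw [BanachSGD.direction, BanachSGD.adjointMap, ContinuousLinearMap.comp_apply,
            BanachSGD.component_apply_eq hw]
          exact map_zero _
        rw [hJ, FunLike.coe_sub, Pi.sub_apply, ih, FunLike.coe_smul, Pi.smul_apply, hdir,
          smul_zero, sub_zero]
    filter_upwards [hmain] with ω hω
    obtain ⟨z, hz, hlim⟩ := hω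
    have hzmin : BanachSGD.IsMinNormSolution A y z :=
      BanachSGD.isMinNormSolution_iff.2 ⟨hz, fun w hw =>
        BanachSGD.norm_le_of_tendsto hpq.lt hlim fun k =>
          hker _ (by rw [map_sub, hz, hw, sub_self]) k ω⟩
    rw [huniq.unique hxdag hzmin]
    exact BanachSGD.tendsto_bregman_zero hpq hlim
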